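/- Let $K$ be a field and let $X_\bullet:(\mathbb R,\le)\to\mathrm{Top}$ be a persistent space, i.e. a functor from the poset $(\mathbb R,\le)$ to topological spaces. Write $H^*(X_t)=\bigoplus_{p\ge 0}H^p(X_t)$ for the singular cohomology ring with coefficients in $K$ and the cup product, and $H^+(X_t)=\bigoplus_{p\ge 1}H^p(X_t)$. For $a\le b$, the persistent cup-length $\mathbf{cup}(X_\bullet)([a,b])\in\mathbb N\cup\{\infty\}$ is the supremum of all $\ell\ge 0$ for which there are $\ell$ homogeneous elements of positive degree in the image ring $\operatorname{im}(H^*(X_b)\to H^*(X_a))$ with non-zero product. For $\ell\ge 1$, the persistent $\ell$-cup module $\Phi^\ell(X_\bullet)$ is the contravariant persistent graded vector space $t\mapsto (H^+(X_t))^\ell$, where $(H^+(X_t))^\ell$ is the (non-unital) subalgebra generated by all $\ell$-fold products of elements of $H^+(X_t)$. An interval is a non-empty order-connected subset $J\subseteq\mathbb R$ (its endpoints may be open, closed or infinite), and its interval module $K_J$ is the contravariant persistence module that is $K$ on $J$ and $0$ elsewhere, with identity maps inside $J$. A barcode of a persistence module $M$ is a family of intervals $(J_l)_{l\in L}$ with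 $M\cong\bigoplus_{l\in L}K_{J_l}$. Whenever the degree-$p$ components $\deg_p\Phi^\ell(X_\bullet)$ have barcodes, put $\mathbf{barc}(\Phi^\ell(X_\bullet))=\bigsqcup_{p\ge1}\mathbf{barc}(\deg_p\Phi^\ell(X_\bullet))$. All suprema below are taken in $\mathbb N\cup\{\infty\}$ with $\sup\emptyset=0$; a supremum is a maximum whenever it is finite and the set is non-empty. 1. Suppose that $X_\bullet$ has q-tame persistent cohomology (for every $p$ and all $s<t$ the map $H^p(X_t)\to H^p(X_s)$ has finite rank) and that its set of critical values is discrete, where $t$ is critical if no neighbourhood $(t-\varepsilon,t+\varepsilon)$ exists in which all maps $H^*(X_{s'})\to H^*(X_s)$, $s\le s'$, are bijective. Then $\deg_p\Phi^\ell(X_\bullet)$ has a barcode for all $\ell,p\ge 1$. 2. For every persistent space $X_\bullet$ for which all $\deg_p\Phi^\ell(X_\bullet)$, $\ell,p\geq 1$, have barcodes, for every choice of barcodes, and for all $a\le b$, $$\mathbf{cup}(X_\bullet)([a,b])=\sup_{J\supseteq[a,b]}\ \sup\{\ell\ge 1 : J\in\mathbf{barc}(\Phi^\ell(X_\bullet))\},$$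 where $J$ ranges over the intervals that contain $[a,b]$. 3. The map $J\mapsto\sup\{\ell\ge1 : J\in\mathbf{barc}(\Phi^\ell(X_\bullet))\}$ does not depend on the chosen decompositions into interval modules (in particular, not on a choice of representative cocycles). -/

import Mathlib

open CategoryTheory

universe u v w

noncomputable section

open Opposite
open scoped Simplicial DirectSum

namespace CupPersistence

/-! ### Cochains of a simplicial set, coboundary and cup product -/

/-- The `n`-cochains of a simplicial set with coefficients in `K`. -/
abbrev Cochain (K : Type v) (S : SSet.{u}) (n : ℕ) : Type (max u v) := S _⦋n⦌ → K

/-- The inclusion `⦋p⦌ ⟶ ⦋n⦌` of the first `p + 1` vertices. -/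
def front (p n : ℕ) (h : p ≤ n) : ⦋p⦌ ⟶ ⦋n⦌ :=
  SimplexCategory.mkHom
    { toFun := fun i => ⟨i.val, by have := i.isLt; omega⟩
      monotone' := fun _ _ hij => hij }

/-- The inclusion `⦋q⦌ ⟶ ⦋n⦌` of the last `q + 1` vertices, where `p + q = n`. -/
def back (p q n : ℕ) (h : p + q = n) : ⦋q⦌ ⟶ ⦋n⦌ :=
  SimplexCategory.mkHom
    { toFun := fun i => ⟨p + i.val, by have := i.isLt; omega⟩
      monotone' := fun _ _ hij => Nat.add_le_add_left hij p }

section Cochains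

variable (K : Type v) [Field K]

/-- The coboundary `(δ f)(σ) = ∑ i, (-1)^i f(d_i σ)`. -/
def coboundary (S : SSet.{u}) (n : ℕ) : Cochain K S n →ₗ[K] Cochain K S (n + 1) where
  toFun f := fun σ => ∑ i : Fin (n + 2), (-1 : K) ^ (i : ℕ) * f (S.δ i σ)
  map_add' f g := by
    funext σ
    simp [mul_add, Finset.sum_add_distrib]
  map_smul' c f := by
    funext σ
    simp only [Pi.smul_apply, smul_eq_mul, RingHom.id_apply, Finset.mul_sum]
    exact Finset.sum_congr rfl fun i _ => by ring

/-- The Alexander–Whitney cup product of cochains, `p + q = n`: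
`(f ⌣ g)[x₀, …, xₙ] = f[x₀, …, x_p] * g[x_p, …, xₙ]`. -/
def cupCochain (S : SSet.{u}) {p q n : ℕ} (h : p + q = n) :
    Cochain K S p →ₗ[K] Cochain K S q →ₗ[K] Cochain K S n :=
  LinearMap.mk₂ K
    (fun f g σ => f (S.map (front p n (by omega)).op σ) * g (S.map (back p q n h).op σ))
    (fun f f' g => by funext σ; simp [add_mul])
    (fun c f g => by funext σ; simp [mul_assoc])
    (fun f g g' => by funext σ; simp [mul_add])
    (fun c f g => by funext σ; simp [mul_left_comm])

variable {K}

@[simp]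
theorem cupCochain_apply (S : SSet.{u}) {p q n : ℕ} (h : p + q = n) (f : Cochain K S p)
    (g : Cochain K S q) (σ : S _⦋n⦌) :
    cupCochain K S h f g σ =
      f (S.map (front p n (by omega)).op σ) * g (S.map (back p q n h).op σ) := rfl

@[simp]
theorem coboundary_apply (S : SSet.{u}) (n : ℕ) (f : Cochain K S n) (σ : S _⦋n + 1⦌) :
    coboundary K S n f σ = ∑ i : Fin (n + 2), (-1 : K) ^ (i : ℕ) * f (S.δ i σ) := rfl

theorem map_map_op (S : SSet.{u}) {a b c : ℕ} (α : ⦋a⦌ ⟶ ⦋b⦌) (β : ⦋b⦌ ⟶ ⦋c⦌) (σ : S _⦋c⦌) :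
    S.map α.op (S.map β.op σ) = S.map (α ≫ β).op σ := by
  simp

theorem cupCochain_assoc (S : SSet.{u}) {p q r k l n : ℕ} (h₁ : p + q = k) (h₂ : k + r = n)
    (h₃ : q + r = l) (h₄ : p + l = n) (f : Cochain K S p) (g : Cochain K S q)
    (e : Cochain K S r) :
    cupCochain K S h₂ (cupCochain K S h₁ f g) e = cupCochain K S h₄ f (cupCochain K S h₃ g e) := by
  funext σ
  simp only [cupCochain_apply, map_map_op, mul_assoc]
  have e1 : front p k (by omega) ≫ front k n (by omega) = front p n (by omega) := rfl
  have e2 : back p q k h₁ ≫ front k n (by omega) = front q l (by omega) ≫ back p l n h₄ := rfl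
  have e3 : back q r l h₃ ≫ back p l n h₄ = back k r n h₂ := by
    ext i
    change p + (q + i.val) = k + i.val
    omega
  rw [e1, e2, e3]

/-- The face `⦋n⦌ ⟶ ⦋n + 1⦌` that skips the vertex `i`, with a natural number as index. -/
def natFace (n i : ℕ) : ⦋n⦌ ⟶ ⦋n + 1⦌ :=
  SimplexCategory.mkHom
    { toFun := fun j => ⟨if j.val < i then j.val else j.val + 1, by
        have := j.isLt
        split_ifs <;> omega⟩
      monotone' := fun a b hab => by
        have : a.val ≤ b.val := hab
        change (if a.val < i then a.val else a.val + 1) ≤ (if b.val < i then b.val else b.val + 1)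
        split_ifs <;> omega }

theorem natFace_eq (n : ℕ) (i : Fin (n + 2)) : SimplexCategory.δ i = natFace n i.val := by
  ext j
  change ((Fin.succAbove i j : Fin (n + 2)) : ℕ) = if j.val < i.val then j.val else j.val + 1
  simp only [Fin.succAbove, Fin.lt_def, Fin.val_castSucc]
  split_ifs <;> simp

theorem coboundary_apply' (S : SSet.{u}) (n : ℕ) (f : Cochain K S n) (σ : S _⦋n + 1⦌) :
    coboundary K S n f σ =
      ∑ i ∈ Finset.range (n + 2), (-1 : K) ^ i * f (S.map (natFace n i).op σ) := by
  rw [coboundary_apply, Finset.sum_range]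
  refine Finset.sum_congr rfl fun i _ => ?_
  rw [SimplicialObject.δ_def, natFace_eq]

/-- The Leibniz rule `δ(f ⌣ g) = δf ⌣ g + (-1)^p f ⌣ δg`. -/
theorem coboundary_cupCochain (S : SSet.{u}) {p q n : ℕ} (h : p + q = n) (f : Cochain K S p)
    (g : Cochain K S q) :
    coboundary K S n (cupCochain K S h f g) =
      cupCochain K S (p := p + 1) (q := q) (n := n + 1) (by omega) (coboundary K S p f) g +
        (-1 : K) ^ p • cupCochain K S (p := p) (q := q + 1) (n := n + 1) (by omega) f
          (coboundary K S q g) := by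
  funext σ
  have a1 : ∀ i, i ≤ p → front p n (by omega) ≫ natFace n i =
      natFace p i ≫ front (p + 1) (n + 1) (by omega) := fun _ _ => rfl
  have a2 : ∀ i, i ≤ p → back p q n h ≫ natFace n i = back (p + 1) q (n + 1) (by omega) := by
    intro i hi
    ext j
    change (if p + j.val < i then p + j.val else p + j.val + 1) = p + 1 + j.val
    split_ifs <;> omega
  have b1 : ∀ i, front p n (by omega) ≫ natFace n (p + 1 + i) =
      front p (n + 1) (by omega) := by
    intro i
    ext j
    change (if j.val < p + 1 + i then j.val else j.val + 1) = j.val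
    have : j.val < p + 1 := j.isLt
    rw [if_pos (by omega)]
  have b2 : ∀ i, back p q n h ≫ natFace n (p + 1 + i) =
      natFace q (i + 1) ≫ back p (q + 1) (n + 1) (by omega) := by
    intro i
    ext j
    change (if p + j.val < p + 1 + i then p + j.val else p + j.val + 1) =
      p + (if j.val < i + 1 then j.val else j.val + 1)
    split_ifs <;> omega
  have c1 : natFace p (p + 1) ≫ front (p + 1) (n + 1) (by omega) =
      front p (n + 1) (by omega) := by
    ext j
    change (if j.val < p + 1 then j.val else j.val + 1) = j.val
    exact if_pos j.isLt
  have c2 : natFace q 0 ≫ back p (q + 1) (n + 1) (by omega) =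
      back (p + 1) q (n + 1) (by omega) := by
    ext j
    change p + (if j.val < 0 then j.val else j.val + 1) = p + 1 + j.val
    split_ifs <;> omega
  have hn : n + 2 = (p + 1) + (q + 1) := by omega
  simp only [Pi.add_apply, Pi.smul_apply, smul_eq_mul, cupCochain_apply, coboundary_apply',
    map_map_op]
  rw [hn, Finset.sum_range_add, Finset.sum_range_succ (n := p + 1),
    Finset.sum_range_succ' (n := q + 1)]
  simp only [c1, c2, b1, b2]
  have h1 : ∑ i ∈ Finset.range (p + 1), (-1 : K) ^ i *
        (f (S.map (front p n (by omega) ≫ natFace n i).op σ) *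
          g (S.map (back p q n h ≫ natFace n i).op σ)) =
      (∑ i ∈ Finset.range (p + 1), (-1 : K) ^ i *
        f (S.map (natFace p i ≫ front (p + 1) (n + 1) (by omega)).op σ)) *
        g (S.map (back (p + 1) q (n + 1) (by omega)).op σ) := by
    rw [Finset.sum_mul]
    refine Finset.sum_congr rfl fun i hi => ?_
    have hi' : i ≤ p := by
      have := Finset.mem_range.1 hi
      omega
    rw [a1 i hi', a2 i hi', mul_assoc]
  have h2 : ∑ i ∈ Finset.range (q + 1), (-1 : K) ^ (p + 1 + i) *
        (f (S.map (front p (n + 1) (by omega)).op σ) *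
          g (S.map (natFace q (i + 1) ≫ back p (q + 1) (n + 1) (by omega)).op σ)) =
      (-1 : K) ^ p * (f (S.map (front p (n + 1) (by omega)).op σ) *
        ∑ i ∈ Finset.range (q + 1), (-1 : K) ^ (i + 1) *
          g (S.map (natFace q (i + 1) ≫ back p (q + 1) (n + 1) (by omega)).op σ)) := by
    simp only [Finset.mul_sum]
    exact Finset.sum_congr rfl fun i _ => by ring
  rw [h1, h2]
  ring

/-- The unit cochain, constant with value `1`. -/
def oneCochain (K : Type v) [Field K] (S : SSet.{u}) : Cochain K S 0 := fun _ => 1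

theorem coboundary_oneCochain (S : SSet.{u}) : coboundary K S 0 (oneCochain K S) = 0 := by
  funext σ
  simp [oneCochain, Fin.sum_univ_two]

theorem one_cupCochain (S : SSet.{u}) {p : ℕ} (h : 0 + p = p) (f : Cochain K S p) :
    cupCochain K S h (oneCochain K S) f = f := by
  funext σ
  have e : back 0 p p h = 𝟙 _ := by
    ext j
    change 0 + j.val = j.val
    omega
  rw [cupCochain_apply, e]
  simp [oneCochain]

theorem cupCochain_one (S : SSet.{u}) {p : ℕ} (h : p + 0 = p) (f : Cochain K S p) :
    cupCochain K S h f (oneCochain K S) = f := by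
  funext σ
  have e : front p p (by omega) = 𝟙 _ := rfl
  rw [cupCochain_apply, e]
  simp [oneCochain]

variable (K) in
/-- Pullback of cochains along a map of simplicial sets. -/
def cochainMap {S T : SSet.{u}} (φ : S ⟶ T) (n : ℕ) : Cochain K T n →ₗ[K] Cochain K S n where
  toFun f := fun σ => f (φ.app (op ⦋n⦌) σ)
  map_add' _ _ := rfl
  map_smul' _ _ := rfl

theorem cochainMap_apply {S T : SSet.{u}} (φ : S ⟶ T) (n : ℕ) (f : Cochain K T n)
    (σ : S _⦋n⦌) : cochainMap K φ n f σ = f (φ.app (op ⦋n⦌) σ) := rfl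

theorem app_map {S T : SSet.{u}} (φ : S ⟶ T) {a b : ℕ} (α : ⦋a⦌ ⟶ ⦋b⦌) (σ : S _⦋b⦌) :
    φ.app (op ⦋a⦌) (S.map α.op σ) = T.map α.op (φ.app (op ⦋b⦌) σ) :=
  NatTrans.naturality_apply φ α.op σ

theorem coboundary_cochainMap {S T : SSet.{u}} (φ : S ⟶ T) (n : ℕ) (f : Cochain K T n) :
    coboundary K S n (cochainMap K φ n f) = cochainMap K φ (n + 1) (coboundary K T n f) := by
  funext σ
  simp only [coboundary_apply', cochainMap_apply, app_map]

theorem cochainMap_cup {S T : SSet.{u}} (φ : S ⟶ T) {p q n : ℕ} (h : p + q = n)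
    (f : Cochain K T p) (g : Cochain K T q) :
    cochainMap K φ n (cupCochain K T h f g) =
      cupCochain K S h (cochainMap K φ p f) (cochainMap K φ q g) := by
  funext σ
  simp only [cupCochain_apply, cochainMap_apply, app_map]

end Cochains

/-! ### The cohomology algebra -/

section Cohomology

variable (K : Type v) [Field K]

/-- The cocycles of degree `n`. -/
def cocycles (S : SSet.{u}) (n : ℕ) : Submodule K (Cochain K S n) :=
  LinearMap.ker (coboundary K S n)

/-- The coboundaries of degree `n`; there are none but `0` in degree `0`. -/
def coboundaries (S : SSet.{u}) (n : ℕ) : Submodule K (Cochain K S n) :=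
  match n with
  | 0 => ⊥
  | n + 1 => LinearMap.range (coboundary K S n)

/-- The `n`-th cohomology `Zⁿ / Bⁿ` of a simplicial set. -/
def Coh (S : SSet.{u}) (n : ℕ) : Type (max u v) :=
  cocycles K S n ⧸ (coboundaries K S n).submoduleOf (cocycles K S n)

instance (S : SSet.{u}) (n : ℕ) : AddCommGroup (Coh K S n) :=
  inferInstanceAs (AddCommGroup
    (cocycles K S n ⧸ (coboundaries K S n).submoduleOf (cocycles K S n)))

instance (S : SSet.{u}) (n : ℕ) : Module K (Coh K S n) :=
  inferInstanceAs (Module K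
    (cocycles K S n ⧸ (coboundaries K S n).submoduleOf (cocycles K S n)))

/-- The cohomology class of a cocycle. -/
def cohClass (S : SSet.{u}) (n : ℕ) : cocycles K S n →ₗ[K] Coh K S n :=
  ((coboundaries K S n).submoduleOf (cocycles K S n)).mkQ

theorem cohClass_surjective (S : SSet.{u}) (n : ℕ) : Function.Surjective (cohClass K S n) :=
  Submodule.mkQ_surjective _

theorem cohClass_eq_zero (S : SSet.{u}) (n : ℕ) (z : cocycles K S n) :
    cohClass K S n z = 0 ↔ (z : Cochain K S n) ∈ coboundaries K S n :=
  (Submodule.Quotient.mk_eq_zero _).trans Iff.rfl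

theorem cup_mem_cocycles (S : SSet.{u}) {p q n : ℕ} (h : p + q = n) (f : cocycles K S p)
    (g : cocycles K S q) :
    cupCochain K S h (f : Cochain K S p) (g : Cochain K S q) ∈ cocycles K S n := by
  have hf : coboundary K S p (f : Cochain K S p) = 0 := f.2
  have hg : coboundary K S q (g : Cochain K S q) = 0 := g.2
  change coboundary K S n _ = 0
  rw [coboundary_cupCochain, hf, hg]
  simp

theorem cup_mem_coboundaries_left (S : SSet.{u}) {p q n : ℕ} (h : p + q = n)
    (f : Cochain K S p) (hf : f ∈ coboundaries K S p) (g : cocycles K S q) :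
    cupCochain K S h f (g : Cochain K S q) ∈ coboundaries K S n := by
  have hg : coboundary K S q (g : Cochain K S q) = 0 := g.2
  cases p with
  | zero =>
    have hf0 : f = 0 := hf
    rw [hf0, map_zero, LinearMap.zero_apply]
    exact Submodule.zero_mem _
  | succ p =>
    obtain ⟨e, rfl⟩ := hf
    obtain ⟨m, rfl⟩ : ∃ m, n = m + 1 := ⟨p + q, by omega⟩
    refine ⟨cupCochain K S (p := p) (q := q) (n := m) (by omega) e g, ?_⟩
    rw [coboundary_cupCochain, hg]
    simp

theorem cup_mem_coboundaries_right (S : SSet.{u}) {p q n : ℕ} (h : p + q = n)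
    (f : cocycles K S p) (g : Cochain K S q) (hg : g ∈ coboundaries K S q) :
    cupCochain K S h (f : Cochain K S p) g ∈ coboundaries K S n := by
  have hf : coboundary K S p (f : Cochain K S p) = 0 := f.2
  cases q with
  | zero =>
    have hg0 : g = 0 := hg
    rw [hg0, map_zero]
    exact Submodule.zero_mem _
  | succ q =>
    obtain ⟨e, rfl⟩ := hg
    obtain ⟨m, rfl⟩ : ∃ m, n = m + 1 := ⟨p + q, by omega⟩
    refine ⟨(-1 : K) ^ p • cupCochain K S (p := p) (q := q) (n := m) (by omega) f e, ?_⟩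
    rw [map_smul, coboundary_cupCochain, hf, map_zero, LinearMap.zero_apply, zero_add, smul_smul,
      ← mul_pow]
    simp

/-- The cup product of cocycles. -/
def cupCocycle (S : SSet.{u}) {p q n : ℕ} (h : p + q = n) :
    cocycles K S p →ₗ[K] cocycles K S q →ₗ[K] cocycles K S n :=
  LinearMap.mk₂ K (fun f g => ⟨cupCochain K S h f g, cup_mem_cocycles K S h f g⟩)
    (fun f f' g => by ext1; simp)
    (fun c f g => by ext1; simp)
    (fun f g g' => by ext1; simp)
    (fun c f g => by ext1; simp)

/-- The cup product `Hᵖ × H^q → Hⁿ`, `p + q = n`. -/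
def cup (S : SSet.{u}) {p q n : ℕ} (h : p + q = n) :
    Coh K S p →ₗ[K] Coh K S q →ₗ[K] Coh K S n :=
  Submodule.liftQ _
    (LinearMap.flip (Submodule.liftQ _
      (LinearMap.flip ((cupCocycle K S h).compr₂ (cohClass K S n)))
      (fun g hg => by
        refine LinearMap.mem_ker.2 (LinearMap.ext fun f => ?_)
        exact (cohClass_eq_zero K S n _).2 (cup_mem_coboundaries_right K S h f g hg))))
    (fun f hf => by
      refine LinearMap.mem_ker.2 (LinearMap.ext fun g => ?_)
      obtain ⟨g, rfl⟩ := cohClass_surjective K S q g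
      exact (cohClass_eq_zero K S n _).2 (cup_mem_coboundaries_left K S h f hf g))

theorem cup_class (S : SSet.{u}) {p q n : ℕ} (h : p + q = n) (f : cocycles K S p)
    (g : cocycles K S q) :
    cup K S h (cohClass K S p f) (cohClass K S q g) = cohClass K S n (cupCocycle K S h f g) :=
  rfl

/-- The unit class in `H⁰`. -/
def cohOne (S : SSet.{u}) : Coh K S 0 :=
  cohClass K S 0 ⟨oneCochain K S, coboundary_oneCochain S⟩

theorem cup_assoc (S : SSet.{u}) {p q r k l n : ℕ} (h₁ : p + q = k) (h₂ : k + r = n)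
    (h₃ : q + r = l) (h₄ : p + l = n) (x : Coh K S p) (y : Coh K S q) (z : Coh K S r) :
    cup K S h₂ (cup K S h₁ x y) z = cup K S h₄ x (cup K S h₃ y z) := by
  obtain ⟨x, rfl⟩ := cohClass_surjective K S p x
  obtain ⟨y, rfl⟩ := cohClass_surjective K S q y
  obtain ⟨z, rfl⟩ := cohClass_surjective K S r z
  simp only [cup_class]
  exact congrArg _ (Subtype.ext (cupCochain_assoc S h₁ h₂ h₃ h₄ _ _ _))

theorem one_cup (S : SSet.{u}) {p : ℕ} (h : 0 + p = p) (x : Coh K S p) :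
    cup K S h (cohOne K S) x = x := by
  obtain ⟨x, rfl⟩ := cohClass_surjective K S p x
  exact congrArg _ (Subtype.ext (one_cupCochain S h _))

theorem cup_one (S : SSet.{u}) {p : ℕ} (h : p + 0 = p) (x : Coh K S p) :
    cup K S h x (cohOne K S) = x := by
  obtain ⟨x, rfl⟩ := cohClass_surjective K S p x
  exact congrArg _ (Subtype.ext (cupCochain_one S h _))

theorem mk_cup (S : SSet.{u}) {p q n : ℕ} (h : p + q = n) (x : Coh K S p) (y : Coh K S q) :
    GradedMonoid.mk (A := Coh K S) (p + q) (cup K S rfl x y) = GradedMonoid.mk n (cup K S h x y) := by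
  subst h
  rfl

instance (S : SSet.{u}) : GradedMonoid.GOne (Coh K S) where
  one := cohOne K S

instance (S : SSet.{u}) : GradedMonoid.GMul (Coh K S) where
  mul x y := cup K S rfl x y

/-- The cup product makes the cohomology a graded ring. -/
instance (S : SSet.{u}) : DirectSum.GRing (Coh K S) where
  mul_zero x := map_zero (cup K S rfl x)
  zero_mul y := by
    change cup K S rfl 0 y = 0
    rw [map_zero, LinearMap.zero_apply]
  mul_add x y z := map_add (cup K S rfl x) y z
  add_mul x y z := by
    change cup K S rfl (x + y) z = cup K S rfl x z + cup K S rfl y z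
    rw [map_add, LinearMap.add_apply]
  one_mul := fun ⟨p, x⟩ => by
    change GradedMonoid.mk (0 + p) (cup K S rfl (cohOne K S) x) = GradedMonoid.mk p x
    rw [mk_cup K S (Nat.zero_add p), one_cup]
  mul_one := fun ⟨p, x⟩ => by
    change GradedMonoid.mk (p + 0) (cup K S rfl x (cohOne K S)) = GradedMonoid.mk p x
    rw [mk_cup K S (Nat.add_zero p), cup_one]
  mul_assoc := fun ⟨p, x⟩ ⟨q, y⟩ ⟨r, z⟩ => by
    change GradedMonoid.mk (p + q + r) (cup K S rfl (cup K S rfl x y) z) =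
      GradedMonoid.mk (p + (q + r)) (cup K S rfl x (cup K S rfl y z))
    rw [mk_cup K S (Nat.add_assoc p q r), cup_assoc K S rfl (Nat.add_assoc p q r) rfl rfl]
  natCast n := n • cohOne K S
  natCast_zero := zero_smul _ _
  natCast_succ n := succ_nsmul _ n
  intCast n := n • cohOne K S
  intCast_ofNat n := natCast_zsmul _ n
  intCast_negSucc_ofNat n := negSucc_zsmul _ n

theorem gmul_eq_cup (S : SSet.{u}) {p q : ℕ} (x : Coh K S p) (y : Coh K S q) :
    GradedMonoid.GMul.mul x y = cup K S rfl x y := rfl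

/-- The cohomology is a graded algebra over the coefficient field. -/
instance (S : SSet.{u}) : DirectSum.GAlgebra K (Coh K S) where
  toFun :=
    { toFun := fun c => c • cohOne K S
      map_zero' := zero_smul _ _
      map_add' := fun a b => add_smul a b _ }
  map_one := one_smul _ _
  map_mul r s := by
    change GradedMonoid.mk 0 ((r * s) • cohOne K S) =
      GradedMonoid.mk (0 + 0) (cup K S rfl (r • cohOne K S) (s • cohOne K S))
    rw [map_smul, map_smul, LinearMap.smul_apply, one_cup, smul_smul, mul_comm]
  commutes r := fun ⟨p, x⟩ => by
    change GradedMonoid.mk (0 + p) (cup K S rfl (r • cohOne K S) x) =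
      GradedMonoid.mk (p + 0) (cup K S rfl x (r • cohOne K S))
    rw [mk_cup K S (Nat.zero_add p), mk_cup K S (Nat.add_zero p), map_smul, map_smul,
      LinearMap.smul_apply, one_cup, cup_one]
  smul_def r := fun ⟨p, x⟩ => by
    change GradedMonoid.mk p (r • x) = GradedMonoid.mk (0 + p) (cup K S rfl (r • cohOne K S) x)
    rw [mk_cup K S (Nat.zero_add p), map_smul, LinearMap.smul_apply, one_cup]

/-- The graded cohomology ring `H^*(S; K) = ⨁ₚ Hᵖ(S; K)` with the cup product. -/
abbrev CohRing (S : SSet.{u}) : Type (max u v) := ⨁ p, Coh K S p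

variable {S T U : SSet.{u}}

theorem cochainMap_mem_cocycles (φ : S ⟶ T) (n : ℕ) (f : cocycles K T n) :
    cochainMap K φ n (f : Cochain K T n) ∈ cocycles K S n := by
  have hf : coboundary K T n (f : Cochain K T n) = 0 := f.2
  change coboundary K S n _ = 0
  rw [coboundary_cochainMap, hf, map_zero]

theorem cochainMap_mem_coboundaries (φ : S ⟶ T) (n : ℕ) (f : Cochain K T n)
    (hf : f ∈ coboundaries K T n) : cochainMap K φ n f ∈ coboundaries K S n := by
  cases n with
  | zero =>
    have hf0 : f = 0 := hf
    rw [hf0, map_zero]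
    exact Submodule.zero_mem _
  | succ n =>
    obtain ⟨e, rfl⟩ := hf
    exact ⟨cochainMap K φ n e, coboundary_cochainMap φ n e⟩

/-- Pullback of cocycles. -/
def cocycleMap (φ : S ⟶ T) (n : ℕ) : cocycles K T n →ₗ[K] cocycles K S n :=
  (cochainMap K φ n).restrict fun f hf => cochainMap_mem_cocycles K φ n ⟨f, hf⟩

/-- The map `Hⁿ(φ) : Hⁿ(T) → Hⁿ(S)` induced by `φ : S ⟶ T`. -/
def cohMap (φ : S ⟶ T) (n : ℕ) : Coh K T n →ₗ[K] Coh K S n :=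
  Submodule.mapQ _ _ (cocycleMap K φ n) fun f hf => cochainMap_mem_coboundaries K φ n f hf

theorem cohMap_class (φ : S ⟶ T) (n : ℕ) (f : cocycles K T n) :
    cohMap K φ n (cohClass K T n f) = cohClass K S n (cocycleMap K φ n f) := rfl

theorem cohMap_id (n : ℕ) (x : Coh K S n) : cohMap K (𝟙 S) n x = x := by
  obtain ⟨x, rfl⟩ := cohClass_surjective K S n x
  rfl

theorem cohMap_comp (φ : S ⟶ T) (ψ : T ⟶ U) (n : ℕ) (x : Coh K U n) :
    cohMap K (φ ≫ ψ) n x = cohMap K φ n (cohMap K ψ n x) := by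
  obtain ⟨x, rfl⟩ := cohClass_surjective K U n x
  rfl

theorem cohMap_one (φ : S ⟶ T) : cohMap K φ 0 (cohOne K T) = cohOne K S := rfl

theorem cohMap_cup (φ : S ⟶ T) {p q n : ℕ} (h : p + q = n) (x : Coh K T p) (y : Coh K T q) :
    cohMap K φ n (cup K T h x y) = cup K S h (cohMap K φ p x) (cohMap K φ q y) := by
  obtain ⟨x, rfl⟩ := cohClass_surjective K T p x
  obtain ⟨y, rfl⟩ := cohClass_surjective K T q y
  simp only [cup_class, cohMap_class]
  exact congrArg _ (Subtype.ext (cochainMap_cup φ h _ _))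

/-- The graded algebra homomorphism `H^*(φ) : H^*(T) → H^*(S)`. -/
def cohRingMap (φ : S ⟶ T) : CohRing K T →ₐ[K] CohRing K S :=
  DirectSum.toAlgebra K (Coh K T) (fun p => DirectSum.lof K ℕ (Coh K S) p ∘ₗ cohMap K φ p)
    rfl
    (fun {p q} x y => by
      change DirectSum.of (Coh K S) (p + q) (cohMap K φ (p + q) (cup K T rfl x y)) =
        DirectSum.of (Coh K S) p (cohMap K φ p x) * DirectSum.of (Coh K S) q (cohMap K φ q y)
      rw [DirectSum.of_mul_of, gmul_eq_cup, cohMap_cup])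

theorem cohRingMap_lof (φ : S ⟶ T) (p : ℕ) (x : Coh K T p) :
    cohRingMap K φ (DirectSum.lof K ℕ (Coh K T) p x) =
      DirectSum.lof K ℕ (Coh K S) p (cohMap K φ p x) :=
  DirectSum.toModule_lof K p x

end Cohomology

/-! ### Length of a graded ring and cup powers -/

/-- The length of a graded ring: the supremum in `ℕ∞` of the numbers `ℓ` for which some product of
`ℓ` homogeneous elements of positive degree is non-zero. It is the largest such `ℓ` if there is a
largest one, and `⊤` otherwise. -/
def gradedLength {R : Type w} [Ring R] {G : Type*} [SetLike G R] (𝒜 : ℕ → G) : ℕ∞ :=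
  ⨆ (ℓ : ℕ) (_ : ∃ η : Fin ℓ → R, (∀ i, ∃ p, 1 ≤ p ∧ η i ∈ 𝒜 p) ∧ (List.ofFn η).prod ≠ 0),
    (ℓ : ℕ∞)

section CupPower

variable (K : Type v) [Field K]

/-- The grading of the image ring `im (H^*(T) → H^*(S))` by its intersections with the
homogeneous components of `H^*(S)`. -/
def imageGrading {S T : SSet.{u}} (φ : S ⟶ T) (p : ℕ) :
    Submodule K (cohRingMap K φ).range :=
  (LinearMap.range (DirectSum.lof K ℕ (Coh K S) p)).comap
    (cohRingMap K φ).range.val.toLinearMap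

/-- The cup-length of a map: the length of the image ring `im (H^*(T) → H^*(S))`. -/
def mapCupLength {S T : SSet.{u}} (φ : S ⟶ T) : ℕ∞ := gradedLength (imageGrading K φ)

/-- The positive-degree part `H⁺(S) = ⨁_{p ≥ 1} Hᵖ(S)` of the cohomology ring. -/
def positivePart (S : SSet.{u}) : Submodule K (CohRing K S) :=
  ⨆ p : ℕ+, LinearMap.range (DirectSum.lof K ℕ (Coh K S) p)

/-- The `ℓ`-fold product `(H⁺(S))^ℓ`: the subalgebra (without unit) generated by the products of
`ℓ` elements of `H⁺(S)`. -/
def cupPower (S : SSet.{u}) (ℓ : ℕ) : NonUnitalSubalgebra K (CohRing K S) :=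
  NonUnitalAlgebra.adjoin K
    {x | ∃ η : Fin ℓ → CohRing K S, (∀ i, η i ∈ positivePart K S) ∧ (List.ofFn η).prod = x}

/-- The degree-`p` component of `(H⁺(S))^ℓ`, as a subspace of `Hᵖ(S)`. -/
def cupPowerDeg (S : SSet.{u}) (ℓ p : ℕ) : Submodule K (Coh K S p) :=
  (cupPower K S ℓ).toSubmodule.comap (DirectSum.lof K ℕ (Coh K S) p)

variable {S T : SSet.{u}}

theorem cohRingMap_positivePart (φ : S ⟶ T) {x : CohRing K T} (hx : x ∈ positivePart K T) :
    cohRingMap K φ x ∈ positivePart K S := by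
  have : positivePart K T ≤ (positivePart K S).comap (cohRingMap K φ).toLinearMap := by
    refine iSup_le fun p => ?_
    rintro _ ⟨y, rfl⟩
    refine Submodule.mem_iSup_of_mem p ⟨cohMap K φ p y, ?_⟩
    exact (cohRingMap_lof K φ p y).symm
  exact this hx

theorem cohRingMap_cupPower (φ : S ⟶ T) (ℓ : ℕ) {x : CohRing K T} (hx : x ∈ cupPower K T ℓ) :
    cohRingMap K φ x ∈ cupPower K S ℓ := by
  induction hx using NonUnitalAlgebra.adjoin_induction with
  | mem x hx =>
    obtain ⟨η, hη, rfl⟩ := hx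
    refine NonUnitalAlgebra.subset_adjoin K
      ⟨fun i => cohRingMap K φ (η i), fun i => cohRingMap_positivePart K φ (hη i), ?_⟩
    rw [map_list_prod, List.map_ofFn]
    rfl
  | add x y _ _ hx hy => rw [map_add]; exact add_mem hx hy
  | zero => rw [map_zero]; exact zero_mem _
  | mul x y _ _ hx hy => rw [map_mul]; exact mul_mem hx hy
  | smul c x _ hx => rw [map_smul]; exact SMulMemClass.smul_mem c hx

/-- The restriction `deg_p((H⁺(T))^ℓ) → deg_p((H⁺(S))^ℓ)` of `Hᵖ(φ)`. -/
def cupPowerMap (φ : S ⟶ T) (ℓ p : ℕ) : cupPowerDeg K T ℓ p →ₗ[K] cupPowerDeg K S ℓ p :=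
  (cohMap K φ p).restrict fun x hx => by
    have := cohRingMap_cupPower K φ ℓ (x := DirectSum.lof K ℕ (Coh K T) p x) hx
    rwa [cohRingMap_lof] at this

end CupPower

/-! ### Persistence modules and barcodes -/

/-- A (contravariant) persistence module, i.e. a functor from `(ℝ, ≤)` to the opposite of the
category of vector spaces over `K`. -/
structure PersistenceModule (K : Type v) [Field K] where
  /-- the vector space at each parameter -/
  V : ℝ → Type w
  [addCommGroup : ∀ t, AddCommGroup (V t)]
  [module : ∀ t, Module K (V t)]
  /-- the transition maps -/
  map : ∀ {s t : ℝ}, s ≤ t → V t →ₗ[K] V s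
  map_refl : ∀ (t : ℝ) (x : V t), map (le_refl t) x = x
  map_trans : ∀ {r s t : ℝ} (hrs : r ≤ s) (hst : s ≤ t) (x : V t),
    map (hrs.trans hst) x = map hrs (map hst x)

attribute [instance] PersistenceModule.addCommGroup PersistenceModule.module

namespace PersistenceModule

variable {K : Type v} [Field K]

/-- An isomorphism of persistence modules. -/
structure Iso (M : PersistenceModule.{v, w} K) (N : PersistenceModule.{v, u} K) where
  /-- the linear isomorphism at each parameter -/
  equiv : ∀ t, M.V t ≃ₗ[K] N.V t
  naturality : ∀ {s t : ℝ} (h : s ≤ t) (x : M.V t),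
    equiv s (M.map h x) = N.map h (equiv t x)

/-- The direct sum of persistence modules. -/
def directSum {ι : Type u} (M : ι → PersistenceModule.{v, w} K) :
    PersistenceModule.{v, max u w} K where
  V t := ⨁ l, (M l).V t
  map h := DirectSum.lmap fun l => (M l).map h
  map_refl t x := by
    classical
    ext l
    simp [map_refl]
  map_trans hrs hst x := by
    classical
    ext l
    simp [map_trans _ hrs hst]

variable (K) in
/-- The vector space of the interval module of `J` at `t`: it is `K` for `t ∈ J` and `0`
otherwise. -/
def intervalSpace (J : Set ℝ) (t : ℝ) : Submodule K K where
  carrier := {x | t ∉ J → x = 0}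
  add_mem' hx hy ht := by rw [hx ht, hy ht, add_zero]
  zero_mem' _ := rfl
  smul_mem' c x hx ht := by rw [hx ht, smul_zero]

open Classical in
variable (K) in
/-- The interval module of an interval `J`: its transition map from `t` to `s ≤ t` is the identity
of `K` if `s, t ∈ J`, and zero otherwise. -/
def intervalModule (J : Set ℝ) (hJ : J.OrdConnected) : PersistenceModule.{v, v} K where
  V t := intervalSpace K J t
  map {s t} _ :=
    { toFun := fun x => ⟨if s ∈ J then (x : K) else 0, fun hs => if_neg hs⟩
      map_add' := fun x y => by
        ext1
        by_cases hs : s ∈ J <;> simp [hs]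
      map_smul' := fun c x => by
        ext1
        by_cases hs : s ∈ J <;> simp [hs] }
  map_refl t x := by
    ext1
    by_cases ht : t ∈ J
    · exact if_pos ht
    · exact (if_neg ht).trans (x.2 ht).symm
  map_trans {r s t} hrs hst x := by
    ext1
    change (if r ∈ J then (x : K) else 0) = if r ∈ J then (if s ∈ J then (x : K) else 0) else 0
    by_cases hr : r ∈ J
    · by_cases hs : s ∈ J
      · simp [hr, hs]
      · have ht : t ∉ J := fun ht => hs (hJ.out hr ht ⟨hrs, hst⟩)
        simp [hr, hs, x.2 ht]
    · simp [hr]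

/-- A barcode of `M`: a family of intervals (non-empty order-connected sets of reals; the endpoints
may be open, closed or infinite) together with an isomorphism from `M` to the direct sum of their
interval modules. -/
structure Barcode (M : PersistenceModule.{v, max v w} K) where
  /-- the index set of the bars -/
  ι : Type (max v w)
  /-- the bars -/
  bar : ι → Set ℝ
  nonempty : ∀ l, (bar l).Nonempty
  ordConnected : ∀ l, (bar l).OrdConnected
  /-- the interval decomposition -/
  iso : Iso M (directSum fun l => intervalModule K (bar l) (ordConnected l))

end PersistenceModule

/-! ### Persistent spaces -/

section PersistentSpace

variable (K : Type v) [Field K] (X : ℝ ⥤ TopCat.{u})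

/-- The singular simplicial set of the space `X_t`. -/
abbrev sing (t : ℝ) : SSet.{u} := TopCat.toSSet.obj (X.obj t)

/-- The map of singular simplicial sets induced by the transition map `X_s → X_t`. -/
abbrev singMap {s t : ℝ} (h : s ≤ t) : sing X s ⟶ sing X t :=
  TopCat.toSSet.map (X.map (homOfLE h))

theorem cohMap_singMap_refl (t : ℝ) (p : ℕ) (x : Coh K (sing X t) p) :
    cohMap K (singMap X (le_refl t)) p x = x := by
  have : singMap X (le_refl t) = 𝟙 (sing X t) := by
    have h : homOfLE (le_refl t) = 𝟙 t := rfl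
    rw [singMap, h, X.map_id, TopCat.toSSet.map_id]
  rw [this, cohMap_id]

theorem cohMap_singMap_trans {r s t : ℝ} (hrs : r ≤ s) (hst : s ≤ t) (p : ℕ)
    (x : Coh K (sing X t) p) :
    cohMap K (singMap X (hrs.trans hst)) p x =
      cohMap K (singMap X hrs) p (cohMap K (singMap X hst) p x) := by
  have : singMap X (hrs.trans hst) = singMap X hrs ≫ singMap X hst := by
    rw [singMap, ← homOfLE_comp hrs hst, X.map_comp, TopCat.toSSet.map_comp]
  rw [this, cohMap_comp]

/-- The persistent cup-length invariant: the interval `[a, b]` is sent to the length of the image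
ring of `H^*(X_b) → H^*(X_a)`. -/
def persistentCupLength {a b : ℝ} (hab : a ≤ b) : ℕ∞ := mapCupLength K (singMap X hab)

/-- The `p`-th persistent (singular) cohomology of `X`. -/
def persistentCohomology (p : ℕ) : PersistenceModule.{v, max u v} K where
  V t := Coh K (sing X t) p
  map h := cohMap K (singMap X h) p
  map_refl t x := cohMap_singMap_refl K X t p x
  map_trans hrs hst x := cohMap_singMap_trans K X hrs hst p x

/-- The degree-`p` component of the persistent `ℓ`-cup module `t ↦ (H⁺(X_t))^ℓ`. -/
def persistentCupModule (ℓ p : ℕ+) : PersistenceModule.{v, max u v} K where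
  V t := cupPowerDeg K (sing X t) ℓ p
  map h := cupPowerMap K (singMap X h) ℓ p
  map_refl t x := Subtype.ext (cohMap_singMap_refl K X t p x)
  map_trans hrs hst x := Subtype.ext (cohMap_singMap_trans K X hrs hst p x)

/-- A persistence module is q-tame if its transition maps between distinct parameters have finite
rank. -/
def PersistenceModule.IsQTame {K : Type v} [Field K] (M : PersistenceModule.{v, w} K) : Prop :=
  ∀ ⦃s t : ℝ⦄ (h : s < t), FiniteDimensional K (LinearMap.range (M.map h.le))

/-- `t` is a critical value if there is no neighbourhood of `t` throughout which the transition
maps induce isomorphisms of the cohomology rings. -/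
def IsCriticalValue (t : ℝ) : Prop :=
  ¬ ∃ ε > 0, ∀ ⦃s s' : ℝ⦄ (h : s ≤ s'), t - ε < s → s' < t + ε →
    Function.Bijective (cohRingMap K (singMap X h))

variable {K X}

/-- The bars of the persistent `ℓ`-cup module: the bars of its components of all degrees `p ≥ 1`. -/
def cupBars (B : ∀ ℓ p : ℕ+, (persistentCupModule K X ℓ p).Barcode) (ℓ : ℕ+) : Set (Set ℝ) :=
  {J | ∃ (p : ℕ+) (l : (B ℓ p).ι), (B ℓ p).bar l = J}

/-- The largest `ℓ ≥ 1` such that `J` is a bar of the persistent `ℓ`-cup module: `0` if there is no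
such `ℓ`, and `⊤` if there are arbitrarily large ones. -/
def cupBarLength (B : ∀ ℓ p : ℕ+, (persistentCupModule K X ℓ p).Barcode) (J : Set ℝ) : ℕ∞ :=
  ⨆ (ℓ : ℕ+) (_ : J ∈ cupBars B ℓ), ((ℓ : ℕ) : ℕ∞)

end PersistentSpace

end CupPersistence

end

open CupPersistence

/-!
The cup modules inherit finite-rank transition maps and regular parameters from cohomology, so
their barcodes come from the structure of q-tame persistence modules with discretely many critical
values. Such a module is constant on the strata cut out by the critical values, hence pulled back
along a monotone map from a module indexed by `ℤ`. There one chooses bases of the values, adapted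
to the images of the transition maps (well-ordered by inclusion, by finiteness of ranks) and to
their kernels (well-ordered, since indexed by integers), working outwards from `0` so that the
transition maps match basis vectors or kill them; the bars are the classes of matched vectors.

For the cup-length, an `ℓ`-fold product of homogeneous elements of positive degree in the image
ring is the image of a homogeneous `ℓ`-fold product, so a non-zero one exists exactly if some
transition map of a graded piece of the `ℓ`-cup module is non-zero, that is, if some bar contains
`[a, b]`. A bar of one decomposition occurs in any other since natural maps between two interval
modules whose composite is non-zero can exist only if the intervals are equal.
-/

noncomputable section

open scoped DirectSum Pointwise

namespace CupPersistence

open Submodule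

universe w₁

/-! ### Bases adapted to chains of subspaces -/

section AdaptedBases

variable {K : Type v} {V : Type w} [DivisionRing K] [AddCommGroup V] [Module K V]
  {𝓕 𝓖 : Set (Submodule K V)} {S T : Set V} {E F U : Submodule K V}

/-- A family of subspaces that is well-ordered by inclusion. Totality is included: apply the
condition to pairs. -/
def IsWellOrderedChain (𝓕 : Set (Submodule K V)) : Prop :=
  ∀ 𝓖 ⊆ 𝓕, 𝓖.Nonempty → ∃ F, IsLeast 𝓖 F

/-- A linearly independent set `S` is adapted to a family of subspaces if `S ∩ F` spans the part
of each member `F` that lies in the span of `S`. -/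
structure IsAdapted (𝓕 : Set (Submodule K V)) (S : Set V) : Prop where
  linearIndepOn : LinearIndepOn K id S
  inf_span_le : ∀ F ∈ 𝓕, F ⊓ span K S ≤ span K (S ∩ F)

/-- A basis of `V`, regarded as a set of vectors, that contains a basis of each member of `𝓕`. -/
structure IsAdaptedBasis (𝓕 : Set (Submodule K V)) (S : Set V) : Prop extends IsAdapted 𝓕 S where
  span_eq_top : span K S = ⊤

theorem IsAdaptedBasis.le_span (hS : IsAdaptedBasis 𝓕 S) (hF : F ∈ 𝓕) : F ≤ span K (S ∩ F) := by
  simpa only [hS.span_eq_top, inf_top_eq] using hS.inf_span_le F hF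

theorem IsAdapted.mono (hS : IsAdapted 𝓕 S) (h : 𝓖 ⊆ 𝓕) : IsAdapted 𝓖 S :=
  ⟨hS.linearIndepOn, fun F hF => hS.inf_span_le F (h hF)⟩

theorem IsAdaptedBasis.mono (hS : IsAdaptedBasis 𝓕 S) (h : 𝓖 ⊆ 𝓕) : IsAdaptedBasis 𝓖 S :=
  ⟨hS.toIsAdapted.mono h, hS.span_eq_top⟩

theorem isAdapted_empty (𝓕 : Set (Submodule K V)) : IsAdapted 𝓕 ∅ :=
  ⟨linearIndepOn_empty K id, fun F _ => by simp⟩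

theorem exists_mem_span_of_mem_span_sUnion {c : Set (Set V)} (hc : IsChain (· ⊆ ·) c)
    (hne : c.Nonempty) {x : V} (hx : x ∈ span K (⋃₀ c)) : ∃ S ∈ c, x ∈ span K S := by
  obtain ⟨a, T, hTc, -, rfl⟩ := mem_span_iff_exists_finset_subset.1 hx
  obtain ⟨S, hS, hTS⟩ :=
    hc.directedOn.exists_mem_subset_of_finite_of_subset_sUnion hne T.finite_toSet hTc
  exact ⟨S, hS, sum_mem fun v hv => smul_mem _ (a v) (subset_span (hTS hv))⟩

theorem isAdapted_sUnion {c : Set (Set V)} (hc : IsChain (· ⊆ ·) c) (hne : c.Nonempty)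
    (h : ∀ S ∈ c, IsAdapted 𝓕 S) : IsAdapted 𝓕 (⋃₀ c) where
  linearIndepOn := linearIndepOn_sUnion_of_directed hc.directedOn fun S hS => (h S hS).linearIndepOn
  inf_span_le F hF := by
    rintro x ⟨hxF, hx⟩
    obtain ⟨S, hS, hxS⟩ := exists_mem_span_of_mem_span_sUnion hc hne hx
    exact span_mono (Set.inter_subset_inter_left _ (Set.subset_sUnion_of_mem hS))
      ((h S hS).inf_span_le F hF ⟨hxF, hxS⟩)

theorem IsAdapted.insert_of_notMem_span (hS : IsAdapted 𝓕 S) {v : V} (hv : v ∉ span K S)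
    (h : ∀ F ∈ 𝓕, F ⊓ span K (insert v S) ≤ span K S ∨ v ∈ F) :
    IsAdapted 𝓕 (insert v S) where
  linearIndepOn := hS.linearIndepOn.id_insert hv
  inf_span_le F hF := by
    rintro x ⟨hxF, hx⟩
    rcases h F hF with hle | hvF
    · exact span_mono (Set.inter_subset_inter_left _ (Set.subset_insert v S))
        (hS.inf_span_le F hF ⟨hxF, hle ⟨hxF, hx⟩⟩)
    · obtain ⟨a, z, hz, rfl⟩ := mem_span_insert.1 hx
      rw [Set.insert_inter_of_mem hvF]
      exact mem_span_insert.2 ⟨a, z, hS.inf_span_le F hF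
        ⟨(F.add_mem_iff_right (F.smul_mem a hvF)).1 hxF, hz⟩, rfl⟩

theorem IsWellOrderedChain.exists_not_le (h𝓕 : IsWellOrderedChain 𝓕) (hE : ¬E ≤ U) :
    ∃ G ≤ E, ¬G ≤ U ∧ ∀ F ∈ 𝓕, F ⊓ E ≤ U ∨ G ≤ F := by
  by_cases hne : {F ∈ 𝓕 | ¬F ⊓ E ≤ U}.Nonempty
  · obtain ⟨G, hG, hleast⟩ := h𝓕 _ (Set.sep_subset _ _) hne
    refine ⟨G ⊓ E, inf_le_right, hG.2, fun F hF => or_iff_not_imp_left.2 fun hFE => ?_⟩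
    exact inf_le_left.trans (hleast ⟨hF, hFE⟩)
  · rw [Set.not_nonempty_iff_eq_empty, Set.sep_eq_empty_iff_mem_false] at hne
    exact ⟨E, le_rfl, hE, fun F hF => .inl (not_not.1 (hne F hF))⟩

theorem IsAdapted.exists_superset (h𝓕 : IsWellOrderedChain 𝓕) (hS : IsAdapted 𝓕 S)
    (hSE : span K S ≤ E) : ∃ T ⊇ S, IsAdapted 𝓕 T ∧ span K T = E := by
  obtain ⟨T, hST, ⟨hT, hTE⟩, hmax⟩ := zorn_subset_nonempty {T | IsAdapted 𝓕 T ∧ span K T ≤ E}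
    (fun c hc hchain hne => ⟨⋃₀ c, ⟨isAdapted_sUnion hchain hne fun T hT => (hc hT).1,
      span_le.2 (Set.sUnion_subset fun T hT => subset_span.trans (hc hT).2)⟩,
      fun T hT => Set.subset_sUnion_of_mem hT⟩) S ⟨hS, hSE⟩
  refine ⟨T, hST, hT, hTE.antisymm (not_not.1 fun hET => ?_)⟩
  obtain ⟨G, hGE, hGT, hG⟩ := h𝓕.exists_not_le hET
  obtain ⟨v, hvG, hvT⟩ := SetLike.not_le_iff_exists.1 hGT
  have hvTE : span K (insert v T) ≤ E :=
    span_le.2 (Set.insert_subset (hGE hvG) (subset_span.trans hTE))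
  have hvT' : IsAdapted 𝓕 (insert v T) := hT.insert_of_notMem_span hvT fun F hF =>
    (hG F hF).imp (inf_le_inf_left F hvTE).trans fun hGF => hGF hvG
  exact hvT (subset_span (hmax ⟨hvT', hvTE⟩ (Set.subset_insert v T) (Set.mem_insert v T)))

theorem IsAdapted.exists_isAdaptedBasis_superset (h𝓕 : IsWellOrderedChain 𝓕)
    (hS : IsAdapted 𝓕 S) : ∃ T ⊇ S, IsAdaptedBasis 𝓕 T := by
  obtain ⟨T, hST, hT, hspan⟩ := hS.exists_superset h𝓕 le_top
  exact ⟨T, hST, hT, hspan⟩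

theorem isWellOrderedChain_of_finiteDimensional (h𝓕 : IsChain (· ≤ ·) 𝓕)
    (hfin : ∀ F ∈ 𝓕, F ≠ ⊤ → FiniteDimensional K F) : IsWellOrderedChain 𝓕 := by
  rintro 𝓖 h𝓖 ⟨E, hE⟩
  by_cases htop : ∀ F ∈ 𝓖, F = ⊤
  · exact ⟨E, hE, fun F hF => (htop F hF).ge.trans' le_top⟩
  push Not at htop
  obtain ⟨F, ⟨hF, hFtop⟩, hmin⟩ := exists_minimalFor_of_wellFoundedLT
    (fun F => F ∈ 𝓖 ∧ F ≠ ⊤) (fun F => Module.finrank K F) htop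
  refine ⟨F, hF, fun G hG => ?_⟩
  rcases h𝓕.total (h𝓖 hF) (h𝓖 hG) with hFG | hGF
  · exact hFG
  have := hfin F (h𝓖 hF) hFtop
  have hGtop : G ≠ ⊤ := fun h => hFtop (top_unique (h ▸ hGF))
  exact (eq_of_le_of_finrank_le hGF (hmin ⟨hG, hGtop⟩ (finrank_mono hGF))).ge

/-- A set of vectors fills a chain of subspaces in order if it spans each member before it leaves
that member. -/
def FillsInOrder (𝓕 : Set (Submodule K V)) (S : Set V) : Prop :=
  ∀ F ∈ 𝓕, F ≤ span K (S ∩ F) ∨ span K S ≤ F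

theorem fillsInOrder_sUnion {c : Set (Set V)} (h : ∀ S ∈ c, FillsInOrder 𝓕 S) :
    FillsInOrder 𝓕 (⋃₀ c) := by
  refine fun F hF => or_iff_not_imp_left.2 fun hFc => ?_
  refine span_le.2 (Set.sUnion_subset fun S hS => (subset_span (R := K)).trans ?_)
  exact (h S hS F hF).resolve_left fun hle => hFc
    (hle.trans (span_mono (Set.inter_subset_inter_left _ (Set.subset_sUnion_of_mem hS))))

theorem FillsInOrder.superset (hS : FillsInOrder 𝓕 S) (hST : S ⊆ T)
    (h : ∀ F ∈ 𝓕, F ≤ span K S ∨ (span K S ≤ F → span K T ≤ F)) : FillsInOrder 𝓕 T := by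
  intro F hF
  have hmono : span K (S ∩ F) ≤ span K (T ∩ F) := span_mono (Set.inter_subset_inter_left _ hST)
  rcases hS F hF with hFS | hSF
  · exact .inl (hFS.trans hmono)
  · refine (h F hF).imp (fun hFS => hFS.trans ?_) fun hTF => hTF hSF
    rwa [← Set.inter_eq_left.2 (subset_span.trans hSF)]

theorem FillsInOrder.isAdaptedBasis (hS : FillsInOrder 𝓕 S) (hli : LinearIndepOn K id S)
    (hspan : span K S = ⊤) : IsAdaptedBasis 𝓕 S where
  linearIndepOn := hli
  span_eq_top := hspan
  inf_span_le F hF := by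
    rcases hS F hF with hFS | hSF
    · exact inf_le_left.trans hFS
    · rw [top_unique (hspan.ge.trans hSF), top_inf_eq, top_coe, Set.inter_univ]

theorem exists_isAdaptedBasis_isAdaptedBasis (h𝓕 : IsWellOrderedChain 𝓕)
    (h𝓖 : IsWellOrderedChain 𝓖) : ∃ S, IsAdaptedBasis 𝓕 S ∧ IsAdaptedBasis 𝓖 S := by
  obtain ⟨S, -, ⟨hS, hfill⟩, hmax⟩ := zorn_subset_nonempty {S | IsAdapted 𝓖 S ∧ FillsInOrder 𝓕 S}
    (fun c hc hchain hne => ⟨⋃₀ c, ⟨isAdapted_sUnion hchain hne fun S hS => (hc hS).1,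
      fillsInOrder_sUnion fun S hS => (hc hS).2⟩, fun S hS => Set.subset_sUnion_of_mem hS⟩)
    ∅ ⟨isAdapted_empty 𝓖, fun F _ => by simp⟩
  suffices hspan : span K S = ⊤ from
    ⟨S, hfill.isAdaptedBasis hS.linearIndepOn hspan, hS, hspan⟩
  refine top_unique (not_not.1 fun htop => ?_)
  obtain ⟨G, -, hGS, hG⟩ := h𝓕.exists_not_le htop
  obtain ⟨T, hST, hT, hspan⟩ := hS.exists_superset h𝓖 (le_sup_left : _ ≤ span K S ⊔ G)
  have hTfill : FillsInOrder 𝓕 T := hfill.superset hST fun F hF =>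
    (hG F hF).imp (fun h => by rwa [inf_top_eq] at h) fun hGF hSF => hspan ▸ sup_le hSF hGF
  exact hGS ((le_sup_right.trans hspan.ge).trans (span_mono (hmax ⟨hT, hTfill⟩ hST)))

end AdaptedBases

/-! ### Bases matched by a linear map -/

section MatchedBases

variable {K : Type v} {U V W : Type*} [DivisionRing K] [AddCommGroup U] [Module K U]
  [AddCommGroup V] [Module K V] [AddCommGroup W] [Module K W]

/-- A linear map matches `B` with `C` if it maps the vectors of `B` outside its kernel injectively
into `C`. For bases `B` and `C` this makes its matrix a partial permutation matrix. -/
structure IsMatched (f : V →ₗ[K] W) (B : Set V) (C : Set W) : Prop where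
  mapsTo : Set.MapsTo f (B \ LinearMap.ker f) C
  injOn : Set.InjOn f (B \ LinearMap.ker f)

theorem IsMatched.comp {g : V →ₗ[K] W} {f : U →ₗ[K] V} {A : Set U} {B : Set V} {C : Set W}
    (hg : IsMatched g B C) (hf : IsMatched f A B) : IsMatched (g ∘ₗ f) A C := by
  have hdiff {x : U} (hx : x ∈ A \ LinearMap.ker (g ∘ₗ f)) :
      x ∈ A \ LinearMap.ker f ∧ f x ∈ B \ LinearMap.ker g := by
    have hgx : g (f x) ≠ 0 := hx.2
    have hfx : x ∈ A \ LinearMap.ker f := ⟨hx.1, fun h => hgx (by rw [h, map_zero])⟩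
    exact ⟨hfx, hf.mapsTo hfx, hgx⟩
  exact ⟨fun x hx => hg.mapsTo (hdiff hx).2, fun x hx y hy hxy =>
    hf.injOn (hdiff hx).1 (hdiff hy).1 (hg.injOn (hdiff hx).2 (hdiff hy).2 hxy)⟩

variable {f : V →ₗ[K] W} {B : Set V}

theorem injOn_span_diff_ker (hB : LinearIndepOn K id B)
    (hker : LinearMap.ker f ≤ span K (B ∩ LinearMap.ker f)) :
    Set.InjOn f (span K (B \ LinearMap.ker f)) := by
  have hdisj := (linearIndepOn_union_iff Set.disjoint_sdiff_inter).1
    ((Set.sdiff_union_inter B (LinearMap.ker f)).symm ▸ hB)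
  simp only [Set.image_id] at hdisj
  exact LinearMap.injOn_of_disjoint_ker le_rfl (hdisj.2.2.mono_right hker)

variable {𝓕 : Set (Submodule K W)}

theorem IsAdaptedBasis.image_diff_ker (hB : IsAdaptedBasis (comap f '' 𝓕) B)
    (hinj : Set.InjOn f (span K (B \ LinearMap.ker f))) :
    IsAdapted 𝓕 (f '' (B \ LinearMap.ker f)) where
  linearIndepOn := (hB.linearIndepOn.mono Set.sdiff_subset).id_imageₛ hinj
  inf_span_le F hF := by
    rintro y ⟨hyF, hy⟩
    obtain ⟨x, -, rfl⟩ := map_span f (B \ LinearMap.ker f) ▸ hy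
    have hx : x ∈ span K (B ∩ comap f F) := hB.le_span (Set.mem_image_of_mem _ hF) hyF
    refine (span_le (p := comap f (span K _))).2 (fun b hb => ?_) hx
    by_cases hfb : f b = 0
    · exact mem_comap.2 (hfb ▸ zero_mem _)
    · exact subset_span ⟨Set.mem_image_of_mem f ⟨hb.1, hfb⟩, hb.2⟩

theorem IsAdaptedBasis.exists_isMatched_right (h𝓕 : IsWellOrderedChain 𝓕) (hbot : ⊥ ∈ 𝓕)
    (hB : IsAdaptedBasis (comap f '' 𝓕) B) : ∃ C, IsAdaptedBasis 𝓕 C ∧ IsMatched f B C := by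
  have hinj := injOn_span_diff_ker hB.linearIndepOn
    (hB.le_span (Set.mem_image_of_mem _ hbot))
  obtain ⟨C, hsub, hC⟩ := (hB.image_diff_ker hinj).exists_isAdaptedBasis_superset h𝓕
  exact ⟨C, hC, fun _ hb => hsub (Set.mem_image_of_mem f hb), hinj.mono subset_span⟩

variable {𝓖 : Set (Submodule K V)} {C : Set W}

theorem IsWellOrderedChain.exists_lift (h𝓖 : IsWellOrderedChain 𝓖) (htop : ⊤ ∈ 𝓖) {w : W}
    (hw : w ∈ LinearMap.range f) : ∃ v, f v = w ∧ ∀ F ∈ 𝓖, w ∈ map f F → v ∈ F := by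
  obtain ⟨G, ⟨-, v, hvG, rfl⟩, hmin⟩ := h𝓖 {F ∈ 𝓖 | w ∈ map f F} (Set.sep_subset _ _)
    ⟨⊤, htop, f.range_eq_map ▸ hw⟩
  exact ⟨v, rfl, fun F hF hwF => hmin ⟨hF, hwF⟩ hvG⟩

theorem linearIndepOn_union_lift {S : Set V} {g : W → V} {C : Set W}
    (hS : LinearIndepOn K id S) (hSker : span K S ≤ LinearMap.ker f)
    (hC : LinearIndepOn K id C) (hg : ∀ w ∈ C, f (g w) = w) :
    LinearIndepOn K id (S ∪ g '' C) := by
  have hfg : LinearIndepOn K (f ∘ g) C := hC.congr fun w hw => (hg w hw).symm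
  refine hS.id_union (hfg.of_comp f).id_image ?_
  have hdisj := range_ker_disjoint (v := fun w : C => g w) hfg
  rw [← Set.image_eq_range] at hdisj
  exact hdisj.symm.mono_left hSker

theorem le_span_union_lift {S : Set V} {g : W → V} {C : Set W} {F : Submodule K V}
    (hS : F ⊓ LinearMap.ker f ≤ span K (S ∩ F)) (hC : map f F ≤ span K (C ∩ map f F))
    (hgF : ∀ w ∈ C, w ∈ map f F → g w ∈ F ∧ f (g w) = w) : F ≤ span K ((S ∪ g '' C) ∩ F) := by
  set T := g '' C ∩ F
  have hmap : map f F ≤ map f (span K T) := by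
    rw [map_span]
    exact hC.trans (span_mono fun w hw => ⟨g w, ⟨⟨w, hw.1, rfl⟩, (hgF w hw.1 hw.2).1⟩,
      (hgF w hw.1 hw.2).2⟩)
  have hTF : span K T ≤ F := span_le.2 Set.inter_subset_right
  calc F ≤ (span K T ⊔ LinearMap.ker f) ⊓ F := le_inf ((LinearMap.map_le_map_iff f).1 hmap) le_rfl
    _ = span K T ⊔ F ⊓ LinearMap.ker f := by rw [sup_inf_assoc_of_le _ hTF, inf_comm]
    _ ≤ span K T ⊔ span K (S ∩ F) := sup_le_sup_left hS _
    _ = span K ((S ∪ g '' C) ∩ F) := by rw [Set.union_inter_distrib_right, span_union, sup_comm]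

theorem IsAdaptedBasis.exists_isMatched_left (h𝓖 : IsWellOrderedChain 𝓖) (htop : ⊤ ∈ 𝓖)
    (hC : IsAdaptedBasis (map f '' 𝓖) C) : ∃ B, IsAdaptedBasis 𝓖 B ∧ IsMatched f B C := by
  obtain ⟨S, -, hS, hSker⟩ := (isAdapted_empty 𝓖).exists_superset h𝓖
    (span_empty.trans_le (bot_le (a := LinearMap.ker f)))
  choose! g hfg hg using fun w (hw : w ∈ LinearMap.range f) => h𝓖.exists_lift htop hw
  set B := S ∪ g '' (C ∩ LinearMap.range f)
  have hBF : ∀ F ∈ 𝓖, F ≤ span K (B ∩ F) := fun F hF => by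
    refine le_span_union_lift (f := f) (hSker ▸ hS.inf_span_le F hF) ?_
      fun w hw hwF => ⟨hg w hw.2 F hF hwF, hfg w hw.2⟩
    rw [Set.inter_assoc, Set.inter_eq_right.2 (LinearMap.map_le_range (f := f) (p := F))]
    exact hC.le_span (Set.mem_image_of_mem _ hF)
  have hspan : span K B = ⊤ := top_unique (by simpa using hBF ⊤ htop)
  have hli : LinearIndepOn K id B := linearIndepOn_union_lift hS.linearIndepOn hSker.le
    (hC.linearIndepOn.mono Set.inter_subset_left) fun w hw => hfg w hw.2
  have hlift : ∀ v ∈ B \ LinearMap.ker f, ∃ w ∈ C ∩ LinearMap.range f, g w = v := fun v hv =>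
    hv.1.resolve_left fun hvS => hv.2 (hSker.le (subset_span hvS))
  refine ⟨B, ⟨⟨hli, fun F hF => inf_le_left.trans (hBF F hF)⟩, hspan⟩, fun v hv => ?_,
    fun v hv v' hv' h => ?_⟩
  · obtain ⟨w, hw, rfl⟩ := hlift v hv
    exact (hfg w hw.2).symm ▸ hw.1
  · obtain ⟨w, hw, rfl⟩ := hlift v hv
    obtain ⟨w', hw', rfl⟩ := hlift v' hv'
    rw [hfg w hw.2, hfg w' hw'.2] at h
    rw [h]

end MatchedBases

/-! ### Matched bases along a bi-infinite sequence of parameters -/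

theorem exists_int_family {A : ℤ → Type*} [∀ n, Nonempty (A n)] {P Q : ∀ n, A n → Prop}
    {R : ∀ m n, A m → A n → Prop}
    (zero : ∃ a, P 0 a ∧ Q 0 a)
    (succ : ∀ n a, P n a → ∃ b, P (n + 1) b ∧ R n (n + 1) a b)
    (pred : ∀ n a, Q n a → ∃ b, Q (n - 1) b ∧ R (n - 1) n b a) :
    ∃ a : ∀ n, A n, (∀ n, P n (a n) ∨ Q n (a n)) ∧ ∀ n, R n (n + 1) (a n) (a (n + 1)) := by
  obtain ⟨a₀, hP₀, hQ₀⟩ := zero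
  choose! next hnextP hnextR using succ
  choose! prev hprevQ hprevR using pred
  let a (n : ℤ) : A n := Int.inductionOn' n 0 a₀ (fun k _ => next k) (fun k _ => prev k)
  have ha_succ {n : ℤ} (hn : 0 ≤ n) : a (n + 1) = next n (a n) := Int.inductionOn'_add_one hn
  have ha_pred {n : ℤ} (hn : n ≤ 0) : a (n - 1) = prev n (a n) := Int.inductionOn'_sub_one hn
  have ha_zero : a 0 = a₀ := Int.inductionOn'_self
  have hP : ∀ n, 0 ≤ n → P n (a n) := fun n hn => by
    induction n, hn using Int.leInduction with
    | base => exact ha_zero ▸ hP₀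
    | succ n hn ih => exact ha_succ hn ▸ hnextP n _ ih
  have hQ : ∀ n ≤ 0, Q n (a n) := fun n hn => by
    induction n, hn using Int.leInductionDown with
    | base => exact ha_zero ▸ hQ₀
    | pred n hn ih => exact ha_pred hn ▸ hprevQ n _ ih
  refine ⟨a, fun n => (le_total 0 n).imp (hP n) (hQ n), fun n => ?_⟩
  rcases lt_or_ge n 0 with hn | hn
  · obtain ⟨k, rfl⟩ : ∃ k, n = k - 1 := ⟨n + 1, (add_sub_cancel_right n 1).symm⟩
    have hk : k ≤ 0 := by omega
    rw [sub_add_cancel, ha_pred hk]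
    exact hprevR k _ (hQ k hk)
  · rw [ha_succ hn]
    exact hnextR n _ (hP n hn)

namespace PersistenceModule

variable {K : Type v} [Field K]

theorem map_comp (M : PersistenceModule.{v, w} K) {r s t : ℝ} (hrs : r ≤ s) (hst : s ≤ t) :
    M.map hrs ∘ₗ M.map hst = M.map (hrs.trans hst) :=
  LinearMap.ext fun x => (M.map_trans hrs hst x).symm

/-- The reparametrization of a persistence module along a monotone map. -/
def comap (M : PersistenceModule.{v, w} K) {ρ : ℝ → ℝ} (hρ : Monotone ρ) :
    PersistenceModule.{v, w} K where
  V t := M.V (ρ t)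
  map h := M.map (hρ h)
  map_refl t x := M.map_refl (ρ t) x
  map_trans hrs hst x := M.map_trans (hρ hrs) (hρ hst) x

/-- Bases of all the spaces of a persistence module that are matched by its transition maps. -/
structure MatchedBases (M : PersistenceModule.{v, w} K) where
  /-- the basis at each parameter, as a set of vectors -/
  B : ∀ t, Set (M.V t)
  linearIndepOn : ∀ t, LinearIndepOn K id (B t)
  span_eq_top : ∀ t, span K (B t) = ⊤
  isMatched : ∀ ⦃s t : ℝ⦄ (h : s ≤ t), IsMatched (M.map h) (B t) (B s)

variable (M : PersistenceModule.{v, w} K) {σ : ℤ → ℝ} (hσ : Monotone σ)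

/-- The kernels of the maps out of `M.V (σ n)` to the earlier members of the sequence. -/
def kernelChain (n : ℤ) : Set (Submodule K (M.V (σ n))) :=
  Set.range fun m : Set.Iic n => LinearMap.ker (M.map (hσ m.2))

/-- The images in `M.V (σ n)` of the later members of the sequence. -/
def imageChain (n : ℤ) : Set (Submodule K (M.V (σ n))) :=
  Set.range fun m : Set.Ici n => LinearMap.range (M.map (hσ m.2))

theorem bot_mem_kernelChain (n : ℤ) : ⊥ ∈ M.kernelChain hσ n :=
  ⟨⟨n, Set.self_mem_Iic⟩, LinearMap.ker_eq_bot'.2 fun x hx => (M.map_refl _ x).symm.trans hx⟩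

theorem top_mem_imageChain (n : ℤ) : ⊤ ∈ M.imageChain hσ n :=
  ⟨⟨n, Set.self_mem_Ici⟩, LinearMap.range_eq_top.2 fun x => ⟨x, M.map_refl _ x⟩⟩

theorem ker_map_antitone {r s t : ℝ} (hrs : r ≤ s) (hst : s ≤ t) :
    LinearMap.ker (M.map hst) ≤ LinearMap.ker (M.map (hrs.trans hst)) :=
  M.map_comp hrs hst ▸ LinearMap.ker_le_ker_comp _ _

theorem range_map_antitone {r s t : ℝ} (hrs : r ≤ s) (hst : s ≤ t) :
    LinearMap.range (M.map (hrs.trans hst)) ≤ LinearMap.range (M.map hrs) :=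
  M.map_comp hrs hst ▸ LinearMap.range_comp_le_range _ _

theorem isWellOrderedChain_kernelChain (n : ℤ) : IsWellOrderedChain (M.kernelChain hσ n) := by
  rintro 𝓖 h𝓖 ⟨F, hF⟩
  obtain ⟨m₀, rfl⟩ := h𝓖 hF
  obtain ⟨m, ⟨hm, hm𝓖⟩, hmax⟩ := Int.exists_greatest_of_bdd
    (P := fun m => ∃ h : m ≤ n, LinearMap.ker (M.map (hσ h)) ∈ 𝓖) ⟨n, fun m hm => hm.1⟩
    ⟨m₀, m₀.2, hF⟩
  refine ⟨_, hm𝓖, fun G hG => ?_⟩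
  obtain ⟨k, rfl⟩ := h𝓖 hG
  exact M.ker_map_antitone (hσ (hmax k ⟨k.2, hG⟩)) (hσ hm)

theorem isChain_imageChain (n : ℤ) : IsChain (· ≤ ·) (M.imageChain hσ n) := by
  rintro _ ⟨⟨m, hm⟩, rfl⟩ _ ⟨⟨k, hk⟩, rfl⟩ -
  rcases le_total m k with hmk | hkm
  · exact .inr (M.range_map_antitone (hσ hm) (hσ hmk))
  · exact .inl (M.range_map_antitone (hσ hk) (hσ hkm))

variable {M} in
theorem IsQTame.isWellOrderedChain_imageChain (hM : M.IsQTame) (hσ : StrictMono σ) (n : ℤ) :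
    IsWellOrderedChain (M.imageChain hσ.monotone n) := by
  refine isWellOrderedChain_of_finiteDimensional (M.isChain_imageChain _ n) ?_
  rintro _ ⟨⟨m, hm⟩, rfl⟩ htop
  rcases (Set.mem_Ici.1 hm).eq_or_lt with rfl | hlt
  · exact absurd (LinearMap.range_eq_top.2 fun x => ⟨x, M.map_refl _ x⟩) htop
  · exact hM (hσ hlt)

theorem comap_image_kernelChain_subset {m n : ℤ} (h : m ≤ n) :
    Submodule.comap (M.map (hσ h)) '' M.kernelChain hσ m ⊆ M.kernelChain hσ n := by
  rintro _ ⟨_, ⟨⟨k, hk⟩, rfl⟩, rfl⟩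
  refine ⟨⟨k, hk.trans h⟩, ?_⟩
  simp only [← LinearMap.ker_comp, map_comp]

theorem map_image_imageChain_subset {m n : ℤ} (h : m ≤ n) :
    Submodule.map (M.map (hσ h)) '' M.imageChain hσ n ⊆ M.imageChain hσ m := by
  rintro _ ⟨_, ⟨⟨k, hk⟩, rfl⟩, rfl⟩
  refine ⟨⟨k, h.trans hk⟩, ?_⟩
  simp only [← LinearMap.range_comp, map_comp]

variable {M}

theorem IsQTame.exists_matched_bases (hM : M.IsQTame) (hσ : StrictMono σ) :
    ∃ B : ∀ n, Set (M.V (σ n)), (∀ n, LinearIndepOn K id (B n) ∧ span K (B n) = ⊤) ∧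
      ∀ ⦃m n⦄ (h : m ≤ n), IsMatched (M.map (hσ.monotone h)) (B n) (B m) := by
  obtain ⟨B, hB, hmatch⟩ := exists_int_family
    (P := fun n => IsAdaptedBasis (M.imageChain hσ.monotone n))
    (Q := fun n => IsAdaptedBasis (M.kernelChain hσ.monotone n))
    (R := fun m n B C => ∀ h : m ≤ n, IsMatched (M.map (hσ.monotone h)) C B)
    (exists_isAdaptedBasis_isAdaptedBasis (hM.isWellOrderedChain_imageChain hσ 0)
      (M.isWellOrderedChain_kernelChain _ 0))
    (fun n B hB => by
      obtain ⟨C, hC, hCB⟩ := IsAdaptedBasis.exists_isMatched_left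
        (hM.isWellOrderedChain_imageChain hσ (n + 1)) (M.top_mem_imageChain _ _)
        (hB.mono (M.map_image_imageChain_subset _ (Int.le_add_one le_rfl)))
      exact ⟨C, hC, fun _ => hCB⟩)
    (fun n B hB => by
      obtain ⟨C, hC, hBC⟩ := IsAdaptedBasis.exists_isMatched_right
        (M.isWellOrderedChain_kernelChain _ (n - 1)) (M.bot_mem_kernelChain _ _)
        (hB.mono (M.comap_image_kernelChain_subset _ (Int.sub_le_self n one_pos.le)))
      exact ⟨C, hC, fun _ => hBC⟩)
  refine ⟨B, fun n => (hB n).elim (fun h => ⟨h.linearIndepOn, h.span_eq_top⟩)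
    fun h => ⟨h.linearIndepOn, h.span_eq_top⟩, fun m n h => ?_⟩
  induction n, h using Int.leInduction with
  | base => exact ⟨fun x hx => by simpa only [map_refl] using hx.1,
      fun x _ y _ hxy => by simpa only [map_refl] using hxy⟩
  | succ n hmn ih =>
    have hn : n ≤ n + 1 := Int.le_add_one le_rfl
    exact M.map_comp (hσ.monotone hmn) (hσ.monotone hn) ▸ ih.comp (hmatch n hn)

theorem IsQTame.nonempty_matchedBases_comap (hM : M.IsQTame) (hσ : StrictMono σ) {r : ℝ → ℤ}
    (hr : Monotone r) : Nonempty (M.comap (hσ.monotone.comp hr)).MatchedBases := by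
  obtain ⟨B, hB, hmatch⟩ := hM.exists_matched_bases hσ
  exact ⟨⟨fun t => B (r t), fun t => (hB (r t)).1, fun t => (hB (r t)).2,
    fun _ _ h => hmatch (hr h)⟩⟩

end PersistenceModule

/-! ### Barcodes from matched bases -/

namespace PersistenceModule

variable {K : Type v} [Field K]

/-- The composition of isomorphisms of persistence modules. -/
def Iso.trans {M N : PersistenceModule.{v, w} K} {P : PersistenceModule.{v, u} K} (e : Iso M N)
    (e' : Iso N P) : Iso M P where
  equiv t := (e.equiv t).trans (e'.equiv t)
  naturality h x := by simp only [LinearEquiv.trans_apply, e.naturality, e'.naturality]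

/-- The barcode of a persistence module carried over to an isomorphic one. -/
def Barcode.ofIso {M N : PersistenceModule.{v, max v w} K} (B : N.Barcode) (e : Iso M N) :
    M.Barcode :=
  { B with iso := e.trans B.iso }

/-- The unit of the interval module of `J` at a parameter in `J`. -/
def intervalUnit {J : Set ℝ} {t : ℝ} (ht : t ∈ J) : intervalSpace K J t :=
  ⟨1, fun h => absurd ht h⟩

theorem eq_smul_intervalUnit {J : Set ℝ} {t : ℝ} (ht : t ∈ J) (x : intervalSpace K J t) :
    x = (x : K) • intervalUnit ht :=
  Subtype.ext (mul_one (x : K)).symm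

section IntervalBasis

variable {ι : Type w} {J : ι → Set ℝ}

open Classical in
/-- The unit of the bar with index `l` in a direct sum of interval modules. -/
def barUnit {t : ℝ} (l : {l // t ∈ J l}) : ⨁ l, intervalSpace K (J l) t :=
  DirectSum.lof K ι (fun l => intervalSpace K (J l) t) l (intervalUnit l.2)

theorem linearIndependent_barUnit (t : ℝ) :
    LinearIndependent K (barUnit (K := K) (J := J) (t := t)) := by
  classical
  refine .of_pairwise_dual_eq_zero_one _
    (fun l => (intervalSpace K (J l) t).subtype ∘ₗ
      DirectSum.component K ι (fun l => intervalSpace K (J l) t) l.1)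
    (fun l l' hll' => ?_) fun l => ?_
  · have hne : l'.1 ≠ l.1 := fun h => hll' (Subtype.ext h.symm)
    simp [barUnit, DirectSum.component.of, hne]
  · simp [barUnit, DirectSum.component.lof_self, intervalUnit]

theorem span_range_barUnit (t : ℝ) :
    ⊤ ≤ span K (Set.range (barUnit (K := K) (J := J) (t := t))) := by
  classical
  rintro x -
  induction x using DirectSum.induction_on with
  | zero => exact zero_mem _
  | add x y hx hy => exact add_mem hx hy
  | of l x =>
    by_cases hl : t ∈ J l
    · rw [eq_smul_intervalUnit hl x, ← DirectSum.lof_eq_of K, map_smul]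
      exact smul_mem _ _ (subset_span ⟨⟨l, hl⟩, rfl⟩)
    · rw [show x = 0 from Subtype.ext (x.2 hl), map_zero]
      exact zero_mem _

variable (hJ : ∀ l, (J l).OrdConnected)

/-- The basis of a direct sum of interval modules at `t` given by the units of the intervals that
contain `t`. -/
def intervalBasis (t : ℝ) :
    Module.Basis {l // t ∈ J l} K ((directSum fun l => intervalModule K (J l) (hJ l)).V t) :=
  .mk (linearIndependent_barUnit t) (span_range_barUnit t)

theorem intervalBasis_apply {t : ℝ} (l : {l // t ∈ J l}) :
    intervalBasis (K := K) hJ t l = barUnit l :=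
  Module.Basis.mk_apply (linearIndependent_barUnit t) (span_range_barUnit t) l

theorem map_intervalBasis_of_mem {s t : ℝ} (h : s ≤ t) (l : {l // t ∈ J l}) (hs : s ∈ J l) :
    (directSum fun l => intervalModule K (J l) (hJ l)).map h (intervalBasis hJ t l) =
      intervalBasis hJ s ⟨l.1, hs⟩ := by
  classical
  rw [intervalBasis_apply, intervalBasis_apply]
  exact (DirectSum.lmap_lof _ _ _).trans (congrArg _ (Subtype.ext (if_pos hs)))

theorem map_intervalBasis_of_notMem {s t : ℝ} (h : s ≤ t) (l : {l // t ∈ J l}) (hs : s ∉ J l) :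
    (directSum fun l => intervalModule K (J l) (hJ l)).map h (intervalBasis hJ t l) = 0 := by
  classical
  rw [intervalBasis_apply]
  exact (DirectSum.lmap_lof _ _ _).trans
    ((congrArg _ (Subtype.ext (if_neg hs))).trans (map_zero _))

end IntervalBasis

/-- The isomorphism of persistence modules that carries bases to bases. -/
def Iso.ofBases {M : PersistenceModule.{v, w} K} {N : PersistenceModule.{v, u} K}
    {κ : ℝ → Type*} (b : ∀ t, Module.Basis (κ t) K (M.V t)) (c : ∀ t, Module.Basis (κ t) K (N.V t))
    (hbc : ∀ ⦃s t : ℝ⦄ (h : s ≤ t) (l : κ t),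
      (b s).equiv (c s) (.refl _) (M.map h (b t l)) = N.map h (c t l)) : Iso M N where
  equiv t := (b t).equiv (c t) (.refl _)
  naturality {s t} h x := by
    have hcomm : ((b s).equiv (c s) (.refl _)).toLinearMap ∘ₗ M.map h =
        N.map h ∘ₗ ((b t).equiv (c t) (.refl _)).toLinearMap :=
      (b t).ext fun l => by simpa using hbc h l
    exact LinearMap.congr_fun hcomm x

/-- The barcode of a persistence module given by bases whose members at `t` are indexed by the bars
that contain `t`, and which the transition maps respect. -/
def Barcode.ofBases {M : PersistenceModule.{v, max v w} K} {ι : Type (max v w)} {J : ι → Set ℝ}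
    (hne : ∀ l, (J l).Nonempty) (hJ : ∀ l, (J l).OrdConnected)
    (b : ∀ t, Module.Basis {l // t ∈ J l} K (M.V t))
    (hmem : ∀ ⦃s t : ℝ⦄ (h : s ≤ t) (l : {l // t ∈ J l}) (hs : s ∈ J l),
      M.map h (b t l) = b s ⟨l, hs⟩)
    (hnotMem : ∀ ⦃s t : ℝ⦄ (h : s ≤ t) (l : {l // t ∈ J l}), s ∉ J l → M.map h (b t l) = 0) :
    M.Barcode where
  ι := ι
  bar := J
  nonempty := hne
  ordConnected := hJ
  iso := .ofBases b (intervalBasis hJ) fun s t h l => by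
    by_cases hs : s ∈ J l
    · rw [hmem h l hs, map_intervalBasis_of_mem hJ h l hs]
      simp
    · rw [hnotMem h l hs, map_intervalBasis_of_notMem hJ h l hs, map_zero]

namespace MatchedBases

variable {M : PersistenceModule.{v, w} K} (C : M.MatchedBases)

theorem ne_zero {t : ℝ} {b : M.V t} (hb : b ∈ C.B t) : b ≠ 0 :=
  (C.linearIndepOn t).ne_zero hb

/-- Two members of matched bases lie on the same bar if they have a common non-zero image. -/
def SameBar (x y : Σ t, C.B t) : Prop :=
  ∃ (r : ℝ) (hx : r ≤ x.1) (hy : r ≤ y.1),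
    M.map hx x.2 = M.map hy y.2 ∧ M.map hx x.2 ≠ 0

variable {C}

theorem SameBar.symm {x y : Σ t, C.B t} : C.SameBar x y → C.SameBar y x :=
  fun ⟨r, hx, hy, heq, hne⟩ => ⟨r, hy, hx, heq.symm, heq ▸ hne⟩

theorem SameBar.refl (x : Σ t, C.B t) : C.SameBar x x :=
  ⟨x.1, le_rfl, le_rfl, rfl, by rw [M.map_refl]; exact C.ne_zero x.2.2⟩

theorem SameBar.trans {x y z : Σ t, C.B t} :
    C.SameBar x y → C.SameBar y z → C.SameBar x z := by
  rintro ⟨r, hrx, hry, hxy, hx⟩ ⟨r', hry', hrz', hyz, hy⟩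
  rcases le_total r r' with h | h
  · refine ⟨r, hrx, h.trans hrz', ?_, hx⟩
    rw [hxy, M.map_trans h hry', hyz, ← M.map_trans]
  · have hxy' : M.map (h.trans hrx) x.2 = M.map hry' y.2 := by
      rw [M.map_trans h hrx, hxy, ← M.map_trans]
    exact ⟨r', h.trans hrx, hrz', hxy'.trans hyz, hxy' ▸ hy⟩

variable (C)

/-- The bars of matched bases: the classes of their members under lying on the same bar. -/
def BarIndex : Type w :=
  Quotient (⟨C.SameBar, .refl, .symm, .trans⟩ : Setoid (Σ t, C.B t))

variable {C}

/-- The bar on which a member of matched bases lies. -/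
def barOf {t : ℝ} (b : C.B t) : C.BarIndex :=
  Quotient.mk _ ⟨t, b⟩

theorem barOf_eq_barOf {s t : ℝ} {c : C.B s} {b : C.B t} :
    barOf c = barOf b ↔ C.SameBar ⟨s, c⟩ ⟨t, b⟩ :=
  Quotient.eq

theorem map_mem {s t : ℝ} (h : s ≤ t) (b : C.B t) (hb : M.map h b ≠ 0) : M.map h b ∈ C.B s :=
  (C.isMatched h).mapsTo ⟨b.2, hb⟩

theorem barOf_map {s t : ℝ} (h : s ≤ t) (b : C.B t) (hb : M.map h b ≠ 0) :
    barOf (⟨M.map h b, C.map_mem h b hb⟩ : C.B s) = barOf b :=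
  barOf_eq_barOf.2 ⟨s, le_rfl, h, M.map_refl s _, (M.map_refl s _).trans_ne hb⟩

theorem map_eq_of_barOf_eq {s t : ℝ} (h : s ≤ t) {c : C.B s} {b : C.B t}
    (hcb : barOf c = barOf b) : M.map h b = c := by
  obtain ⟨r, hrs, hrt, heq, hne⟩ := barOf_eq_barOf.1 hcb
  have hmap : M.map hrs (M.map h b) = M.map hrs c := (M.map_trans hrs h _).symm.trans heq.symm
  have hb : M.map h b ≠ 0 := fun h0 => hne (by rw [← hmap, h0, map_zero])
  exact (C.isMatched hrs).injOn ⟨C.map_mem h b hb, hmap.trans_ne hne⟩ ⟨c.2, hne⟩ hmap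

theorem barOf_injective (t : ℝ) : Function.Injective (barOf : C.B t → C.BarIndex) :=
  fun _ b h => Subtype.ext ((map_eq_of_barOf_eq le_rfl h).symm.trans (M.map_refl t b))

/-- The parameters of the members of matched bases that lie on a given bar. -/
def bar (l : C.BarIndex) : Set ℝ :=
  {t | ∃ b : C.B t, barOf b = l}

theorem bar_nonempty (l : C.BarIndex) : (bar l).Nonempty :=
  Quotient.inductionOn l fun x => ⟨x.1, x.2, rfl⟩

theorem ordConnected_bar (l : C.BarIndex) : (bar l).OrdConnected := by
  refine ⟨?_⟩
  rintro r ⟨a, ha⟩ t ⟨b, rfl⟩ s ⟨hrs, hst⟩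
  have hb : M.map hst b ≠ 0 := fun h0 => C.ne_zero a.2 <| by
    rw [← map_eq_of_barOf_eq (hrs.trans hst) ha, M.map_trans hrs hst, h0, map_zero]
  exact ⟨_, barOf_map hst b hb⟩

theorem barOf_bijective (t : ℝ) :
    Function.Bijective fun b : C.B t => (⟨barOf b, b, rfl⟩ : {l : C.BarIndex // t ∈ bar l}) :=
  ⟨fun _ _ h => barOf_injective t (congrArg Subtype.val h), fun ⟨_, b, hb⟩ => ⟨b, Subtype.ext hb⟩⟩

variable (C)

/-- The members of matched bases at `t`, indexed by the bars on which they lie. -/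
def basis (t : ℝ) : Module.Basis {l : C.BarIndex // t ∈ bar l} K (M.V t) :=
  (Module.Basis.mk (C.linearIndepOn t).linearIndependent
    (by simpa using (C.span_eq_top t).ge)).reindex (.ofBijective _ (barOf_bijective t))

variable {C}

theorem basis_of_barOf_eq {t : ℝ} {b : C.B t} {l : C.BarIndex} (hb : barOf b = l) :
    C.basis t ⟨l, b, hb⟩ = b := by
  have hsymm : (Equiv.ofBijective _ (barOf_bijective t)).symm ⟨l, b, hb⟩ = b :=
    (Equiv.symm_apply_eq _).2 (Subtype.ext hb.symm)
  rw [basis, Module.Basis.reindex_apply, hsymm]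
  simp

end MatchedBases

/-- The barcode given by matched bases. -/
def MatchedBases.barcode {M : PersistenceModule.{v, max v w} K} (C : M.MatchedBases) :
    M.Barcode :=
  .ofBases bar_nonempty ordConnected_bar C.basis
    (by
      rintro s t h ⟨_, b, rfl⟩ ⟨c, hcb⟩
      rw [basis_of_barOf_eq rfl, basis_of_barOf_eq hcb]
      exact map_eq_of_barOf_eq h hcb)
    (by
      rintro s t h ⟨_, b, rfl⟩ hs
      rw [basis_of_barOf_eq rfl]
      by_contra hb
      exact hs ⟨_, barOf_map h b hb⟩)

end PersistenceModule

/-! ### Reduction to a discrete set of parameters -/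

theorem exists_strictMono_int_range_eq {D : Set ℝ} (hD : ∀ a b, (D ∩ Set.Icc a b).Finite)
    (habove : ¬ BddAbove D) (hbelow : ¬ BddBelow D) :
    ∃ σ : ℤ → ℝ, StrictMono σ ∧ Set.range σ = D := by
  have : LocallyFiniteOrder D := .ofFiniteIcc fun a b =>
    .of_finite_image ((hD a b).subset (by rintro _ ⟨x, hx, rfl⟩; exact ⟨x.2, hx⟩))
      Subtype.val_injective.injOn
  have : NoMaxOrder D := ⟨fun a =>
    let ⟨b, hb, hab⟩ := not_bddAbove_iff.1 habove a
    ⟨⟨b, hb⟩, hab⟩⟩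
  have : NoMinOrder D := ⟨fun a =>
    let ⟨b, hb, hba⟩ := not_bddBelow_iff.1 hbelow a
    ⟨⟨b, hb⟩, hba⟩⟩
  have : Nonempty D := (nonempty_of_not_bddAbove habove).to_subtype
  let _ : SuccOrder D := LinearLocallyFiniteOrder.succOrder D
  let _ : PredOrder D := LinearLocallyFiniteOrder.predOrder D
  let e : D ≃o ℤ := orderIsoIntOfLinearSuccPredArch
  refine ⟨fun n => e.symm n, fun m n h => e.symm.strictMono h, ?_⟩
  exact (e.symm.surjective.range_comp Subtype.val).trans Subtype.range_coe

theorem exists_isGreatest_inter_Iic {D : Set ℝ} (hD : ∀ a b, (D ∩ Set.Icc a b).Finite)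
    (hbelow : ¬ BddBelow D) (t : ℝ) : ∃ a, IsGreatest (D ∩ Set.Iic t) a := by
  obtain ⟨c, hcD, hct⟩ := not_bddBelow_iff.1 hbelow t
  obtain ⟨a, ⟨haD, hca, hat⟩, hmax⟩ :=
    Set.exists_max_image _ id (hD c t) ⟨c, hcD, le_rfl, hct.le⟩
  exact ⟨a, ⟨haD, hat⟩, fun x ⟨hxD, hxt⟩ => (le_total c x).elim
    (fun hcx => hmax x ⟨hxD, hcx, hxt⟩) fun hxc => hxc.trans hca⟩

theorem exists_isLeast_inter_Ici {D : Set ℝ} (hD : ∀ a b, (D ∩ Set.Icc a b).Finite)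
    (habove : ¬ BddAbove D) (t : ℝ) : ∃ a, IsLeast (D ∩ Set.Ici t) a := by
  obtain ⟨c, hcD, htc⟩ := not_bddAbove_iff.1 habove t
  obtain ⟨a, ⟨haD, hta, hac⟩, hmin⟩ :=
    Set.exists_min_image _ id (hD t c) ⟨c, hcD, htc.le, le_rfl⟩
  exact ⟨a, ⟨haD, hta⟩, fun x ⟨hxD, htx⟩ => (le_total x c).elim
    (fun hxc => hmin x ⟨hxD, htx, hxc⟩) fun hcx => hac.trans hcx⟩

theorem exists_monotone_locallyFinite_range {D : Set ℝ} (hD : ∀ a b, (D ∩ Set.Icc a b).Finite)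
    (habove : ¬ BddAbove D) (hbelow : ¬ BddBelow D) :
    ∃ ρ : ℝ → ℝ, Monotone ρ ∧ (∀ a b, (Set.range ρ ∩ Set.Icc a b).Finite) ∧
      ∀ t, ρ t = t ∨ Disjoint (Set.uIcc t (ρ t)) D := by
  choose lo hlo using exists_isGreatest_inter_Iic hD hbelow
  choose hi hhi using exists_isLeast_inter_Ici hD habove
  have hlo_le (t : ℝ) : lo t ≤ t := (hlo t).1.2
  have hle_hi (t : ℝ) : t ≤ hi t := (hhi t).1.2
  have hgap {t x : ℝ} (hx : x ∈ D) : x ≤ lo t ∨ hi t ≤ x :=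
    (le_total x t).imp (fun h => (hlo t).2 ⟨hx, h⟩) fun h => (hhi t).2 ⟨hx, h⟩
  refine ⟨fun t => (lo t + hi t) / 2, fun s t hst => ?_, fun a b => ?_, fun t => ?_⟩
  · have hlo_mono : lo s ≤ lo t := (hlo t).2 ⟨(hlo s).1.1, (hlo_le s).trans hst⟩
    have hhi_mono : hi s ≤ hi t := (hhi s).2 ⟨(hhi t).1.1, hst.trans (hle_hi t)⟩
    dsimp only
    linarith
  · obtain ⟨c, hcD, hca⟩ := not_bddBelow_iff.1 hbelow a
    obtain ⟨d, hdD, hbd⟩ := not_bddAbove_iff.1 habove b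
    refine (((hD c d).prod (hD c d)).image fun x => (x.1 + x.2) / 2).subset ?_
    rintro _ ⟨⟨t, rfl⟩, ha, hb⟩
    have hlohi : lo t ≤ hi t := (hlo_le t).trans (hle_hi t)
    have hc : c ≤ lo t := (hgap hcD).resolve_right fun h => by linarith
    have hd : hi t ≤ d := (hgap hdD).resolve_left fun h => by linarith
    exact ⟨(lo t, hi t), ⟨⟨(hlo t).1.1, hc, hlohi.trans hd⟩, (hhi t).1.1, hc.trans hlohi, hd⟩, rfl⟩
  · by_cases ht : t ∈ D
    · have hlo_eq : lo t = t := (hlo_le t).antisymm ((hlo t).2 ⟨ht, Set.self_mem_Iic⟩)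
      have hhi_eq : hi t = t := ((hhi t).2 ⟨ht, Set.self_mem_Ici⟩).antisymm (hle_hi t)
      exact .inl (by simp only [hlo_eq, hhi_eq, add_self_div_two])
    · have hlo_lt : lo t < t := (hlo_le t).lt_of_ne fun h => ht (h ▸ (hlo t).1.1)
      have hlt_hi : t < hi t := (hle_hi t).lt_of_ne' fun h => ht (h ▸ (hhi t).1.1)
      have hsub : Set.uIcc t ((lo t + hi t) / 2) ⊆ Set.Ioo (lo t) (hi t) :=
        Set.ordConnected_Ioo.uIcc_subset ⟨hlo_lt, hlt_hi⟩ ⟨by linarith, by linarith⟩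
      exact .inr <| Set.disjoint_left.2 fun x hx hxD =>
        (hgap hxD).elim (hsub hx).1.not_ge (hsub hx).2.not_ge

theorem exists_strata {C : Set ℝ} (hC : ∀ a b, (C ∩ Set.Icc a b).Finite) :
    ∃ (σ : ℤ → ℝ) (r : ℝ → ℤ), StrictMono σ ∧ Monotone r ∧
      ∀ t, σ (r t) = t ∨ Disjoint (Set.uIcc t (σ (r t))) C := by
  let D : Set ℝ := C ∪ Set.range Int.cast
  have hint (n : ℤ) : (n : ℝ) ∈ D := .inr ⟨n, rfl⟩
  have hD (a b : ℝ) : (D ∩ Set.Icc a b).Finite := by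
    rw [Set.union_inter_distrib_right]
    refine (hC a b).union (((Set.finite_Icc ⌈a⌉ ⌊b⌋).image Int.cast).subset ?_)
    rintro _ ⟨⟨n, rfl⟩, ha, hb⟩
    exact ⟨n, ⟨Int.ceil_le.2 ha, Int.le_floor.2 hb⟩, rfl⟩
  have habove {E : Set ℝ} (hE : ∀ n : ℤ, (n : ℝ) ∈ E) : ¬ BddAbove E :=
    not_bddAbove_iff.2 fun x => ⟨_, hE (⌊x⌋ + 1), by exact_mod_cast Int.lt_floor_add_one x⟩
  have hbelow {E : Set ℝ} (hE : ∀ n : ℤ, (n : ℝ) ∈ E) : ¬ BddBelow E :=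
    not_bddBelow_iff.2 fun x => ⟨_, hE (⌈x⌉ - 1), by
      have := Int.ceil_lt_add_one x
      push_cast
      linarith⟩
  obtain ⟨ρ, hmono, hfin, hρ⟩ := exists_monotone_locallyFinite_range hD (habove hint) (hbelow hint)
  have hρint (n : ℤ) : (n : ℝ) ∈ Set.range ρ :=
    ⟨n, (hρ n).resolve_right fun h => Set.disjoint_left.1 h Set.left_mem_uIcc (hint n)⟩
  obtain ⟨σ, hσ, hσρ⟩ := exists_strictMono_int_range_eq hfin (habove hρint) (hbelow hρint)
  choose r hr using fun t => hσρ.ge ⟨t, rfl⟩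
  exact ⟨σ, r, hσ, fun s t hst => hσ.le_iff_le.1 (by simpa only [hr] using hmono hst), fun t =>
    hr t ▸ (hρ t).imp_right fun h => h.mono_right Set.subset_union_left⟩

namespace PersistenceModule

variable {K : Type v} [Field K] (M : PersistenceModule.{v, w} K)

/-- A parameter is regular for a persistence module if the transition maps between any two
parameters close to it are bijective. -/
def IsRegularAt (t : ℝ) : Prop :=
  ∃ ε > 0, ∀ ⦃s s' : ℝ⦄ (h : s ≤ s'), t - ε < s → s' < t + ε → Function.Bijective (M.map h)

variable {M}

theorem map_bijective_of_eq {s t : ℝ} (h : s ≤ t) (hst : s = t) : Function.Bijective (M.map h) := by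
  subst hst
  exact (funext (M.map_refl s) : ⇑(M.map h) = id) ▸ Function.bijective_id

theorem map_bijective_trans {r s t : ℝ} (hrs : r ≤ s) (hst : s ≤ t)
    (h : Function.Bijective (M.map hrs)) (h' : Function.Bijective (M.map hst)) :
    Function.Bijective (M.map (hrs.trans hst)) := by
  rw [← M.map_comp hrs hst, LinearMap.coe_comp]
  exact h.comp h'

theorem map_bijective_of_forall_isRegularAt {a b : ℝ} (hab : a ≤ b)
    (hreg : ∀ t ∈ Set.Icc a b, M.IsRegularAt t) : Function.Bijective (M.map hab) := by
  choose ε hε hbij using fun t : Set.Icc a b => hreg t t.2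
  obtain ⟨u, hu0, humono, ⟨m, hum⟩, hu⟩ := exists_monotone_Icc_subset_open_cover_Icc hab
    (c := fun t => Subtype.val ⁻¹' Set.Ioo (t - ε t) (t + ε t))
    (fun _ => isOpen_Ioo.preimage continuous_subtype_val) fun t _ => Set.mem_iUnion.2
      ⟨t, sub_lt_self _ (hε t), lt_add_of_pos_right _ (hε t)⟩
  have hbij_u (n : ℕ) : Function.Bijective (M.map (u n).2.1) := by
    induction n with
    | zero => exact map_bijective_of_eq _ hu0.symm
    | succ n ih =>
      obtain ⟨t, ht⟩ := hu n
      have hle : u n ≤ u (n + 1) := humono n.le_succ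
      exact map_bijective_trans _ hle ih
        (hbij t hle (ht ⟨le_rfl, hle⟩).1 (ht ⟨hle, le_rfl⟩).2)
  have hub : (u m : ℝ) = b := hum m le_rfl
  exact map_bijective_trans (u m).2.1 hub.le (hbij_u m) (map_bijective_of_eq _ hub)

/-- The isomorphism from a persistence module to its reparametrization along `ρ`, if the transition
maps between `t` and `ρ t` are bijective. -/
def isoComap {ρ : ℝ → ℝ} (hρ : Monotone ρ)
    (hleft : ∀ t, Function.Bijective (M.map (min_le_left t (ρ t))))
    (hright : ∀ t, Function.Bijective (M.map (min_le_right t (ρ t)))) : Iso M (M.comap hρ) where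
  equiv t := (LinearEquiv.ofBijective _ (hleft t)).trans (.symm (.ofBijective _ (hright t)))
  naturality {s t} h x := by
    let e (t : ℝ) : M.V t ≃ₗ[K] M.V (ρ t) :=
      (LinearEquiv.ofBijective _ (hleft t)).trans (.symm (.ofBijective _ (hright t)))
    have he (t : ℝ) (x : M.V t) :
        M.map (min_le_right t (ρ t)) (e t x) = M.map (min_le_left t (ρ t)) x :=
      (LinearEquiv.ofBijective _ (hright t)).apply_symm_apply _
    have hmin : min s (ρ s) ≤ min t (ρ t) := min_le_min h (hρ h)
    refine (hright s).injective ?_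
    calc M.map (min_le_right s (ρ s)) (e s (M.map h x))
        = M.map (min_le_left s (ρ s)) (M.map h x) := he s _
      _ = M.map hmin (M.map (min_le_left t (ρ t)) x) := by simp only [← M.map_trans]
      _ = M.map hmin (M.map (min_le_right t (ρ t)) (e t x)) := by rw [he t x]
      _ = M.map (min_le_right s (ρ s)) (M.map (hρ h) (e t x)) := by simp only [← M.map_trans]

theorem IsQTame.nonempty_barcode {M : PersistenceModule.{v, max v w} K} (hM : M.IsQTame)
    (hreg : ∀ a b, ({t | ¬ M.IsRegularAt t} ∩ Set.Icc a b).Finite) : Nonempty M.Barcode := by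
  obtain ⟨σ, r, hσ, hr, hstrata⟩ := exists_strata hreg
  obtain ⟨C⟩ := hM.nonempty_matchedBases_comap hσ hr
  have hbij {s t u : ℝ} (h : s ≤ t) (hs : s ∈ Set.uIcc u (σ (r u)))
      (ht : t ∈ Set.uIcc u (σ (r u))) : Function.Bijective (M.map h) := by
    rcases hstrata u with hu | hu
    · rw [hu, Set.uIcc_self] at hs ht
      exact map_bijective_of_eq h (hs.trans ht.symm)
    · exact map_bijective_of_forall_isRegularAt h fun x hx => not_not.1 <|
        Set.disjoint_left.1 hu (Set.ordConnected_uIcc.out hs ht hx)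
  have hmin (u : ℝ) : min u (σ (r u)) ∈ Set.uIcc u (σ (r u)) := ⟨le_rfl, inf_le_sup⟩
  exact ⟨C.barcode.ofIso (isoComap _ (fun t => hbij _ (hmin t) Set.left_mem_uIcc)
    fun t => hbij _ (hmin t) Set.right_mem_uIcc)⟩

end PersistenceModule

/-! ### Barcodes of the persistent cup modules -/

section CupModule

variable {K : Type v} [Field K] {S T : SSet.{u}} {φ : S ⟶ T}

theorem cohRingMap_apply (φ : S ⟶ T) (x : CohRing K T) (p : ℕ) :
    cohRingMap K φ x p = cohMap K φ p (x p) := by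
  have hcomp : DirectSum.component K ℕ (Coh K S) p ∘ₗ (cohRingMap K φ).toLinearMap =
      cohMap K φ p ∘ₗ DirectSum.component K ℕ (Coh K T) p := by
    refine DirectSum.linearMap_ext K fun q => LinearMap.ext fun y => ?_
    simp only [LinearMap.comp_apply, AlgHom.toLinearMap_apply, cohRingMap_lof]
    rcases eq_or_ne q p with rfl | hqp
    · simp only [DirectSum.component.lof_self]
    · simp [DirectSum.component.of, hqp]
  exact LinearMap.congr_fun hcomp x

theorem lof_injective (S : SSet.{u}) (p : ℕ) :
    Function.Injective (DirectSum.lof K ℕ (Coh K S) p) :=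
  DirectSum.of_injective p

theorem cohMap_injective (h : Function.Injective (cohRingMap K φ)) (p : ℕ) :
    Function.Injective (cohMap K φ p) := fun x y hxy =>
  lof_injective T p <| h <| by rw [cohRingMap_lof, cohRingMap_lof, hxy]

theorem cohMap_surjective (h : Function.Surjective (cohRingMap K φ)) (p : ℕ) :
    Function.Surjective (cohMap K φ p) := fun y => by
  obtain ⟨x, hx⟩ := h (DirectSum.of _ p y)
  exact ⟨x p, by rw [← cohRingMap_apply, hx, DirectSum.of_eq_same]⟩

theorem positivePart_le_map (h : Function.Surjective (cohRingMap K φ)) :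
    positivePart K S ≤ (positivePart K T).map (cohRingMap K φ).toLinearMap := by
  refine iSup_le fun p => ?_
  rintro _ ⟨y, rfl⟩
  obtain ⟨x, rfl⟩ := cohMap_surjective h p y
  exact ⟨DirectSum.lof K ℕ _ p x, mem_iSup_of_mem p ⟨x, rfl⟩, cohRingMap_lof K φ p x⟩

theorem cohRingMap_prod_ofFn (φ : S ⟶ T) {n : ℕ} (ξ : Fin n → CohRing K T) :
    cohRingMap K φ (List.ofFn ξ).prod = (List.ofFn fun i => cohRingMap K φ (ξ i)).prod := by
  rw [map_list_prod, List.map_ofFn, Function.comp_def]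

theorem cupPower_le_map (h : Function.Surjective (cohRingMap K φ)) (ℓ : ℕ) :
    cupPower K S ℓ ≤ (cupPower K T ℓ).map (cohRingMap K φ) := by
  refine NonUnitalAlgebra.adjoin_le ?_
  rintro _ ⟨η, hη, rfl⟩
  choose ξ hξ hξη using fun i => positivePart_le_map h (hη i)
  obtain rfl : (fun i => cohRingMap K φ (ξ i)) = η := funext hξη
  exact ⟨_, NonUnitalAlgebra.subset_adjoin K ⟨ξ, hξ, rfl⟩, cohRingMap_prod_ofFn φ ξ⟩

theorem cupPowerMap_bijective (h : Function.Bijective (cohRingMap K φ)) (ℓ p : ℕ) :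
    Function.Bijective (cupPowerMap K φ ℓ p) := by
  refine ⟨fun x y hxy => Subtype.ext (cohMap_injective h.1 p (congrArg Subtype.val hxy)),
    fun ⟨y, hy⟩ => ?_⟩
  obtain ⟨z, rfl⟩ := cohMap_surjective h.2 p y
  obtain ⟨x, hx, hxz⟩ := cupPower_le_map h.2 ℓ hy
  obtain rfl : x = DirectSum.lof K ℕ (Coh K T) p z := h.1 (hxz.trans (cohRingMap_lof K φ p z).symm)
  exact ⟨⟨z, hx⟩, rfl⟩

variable {X : ℝ ⥤ TopCat.{u}}

theorem isQTame_persistentCupModule {p : ℕ+} (hX : (persistentCohomology K X p).IsQTame)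
    (ℓ : ℕ+) : (persistentCupModule K X ℓ p).IsQTame := fun s t h => by
  have : FiniteDimensional K (LinearMap.range (cohMap K (singMap X h.le) p)) := hX h
  set R := LinearMap.range (cupPowerMap K (singMap X h.le) ℓ p)
  have hR : R.map (cupPowerDeg K (sing X s) ℓ p).subtype ≤
      LinearMap.range (cohMap K (singMap X h.le) p) := by
    rintro _ ⟨_, ⟨x, rfl⟩, rfl⟩
    exact ⟨x, rfl⟩
  have := Submodule.finiteDimensional_of_le hR
  exact (LinearEquiv.finiteDimensional
    (Submodule.equivMapOfInjective _ (Submodule.subtype_injective _) R).symm :)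

theorem isClosed_setOf_isCriticalValue : IsClosed {t : ℝ | IsCriticalValue K X t} := by
  rw [← isOpen_compl_iff, Metric.isOpen_iff]
  intro t ht
  obtain ⟨ε, hε, hbij⟩ := not_not.1 ht
  refine ⟨ε / 2, half_pos hε, fun t' ht' =>
    not_not.2 ⟨ε / 2, half_pos hε, fun s s' hs hlt hlt' => ?_⟩⟩
  obtain ⟨hgt, hlt''⟩ := abs_lt.1 (Metric.mem_ball.1 ht')
  exact hbij hs (by linarith) (by linarith)

theorem isRegularAt_persistentCupModule {t : ℝ} (ht : ¬ IsCriticalValue K X t) (ℓ p : ℕ+) :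
    (persistentCupModule K X ℓ p).IsRegularAt t := by
  obtain ⟨ε, hε, hbij⟩ := not_not.1 ht
  exact ⟨ε, hε, fun s s' hs hlt hlt' => cupPowerMap_bijective (hbij hs hlt hlt') ℓ p⟩

theorem nonempty_barcode_persistentCupModule
    (hX : ∀ p : ℕ, (persistentCohomology K X p).IsQTame)
    (hcrit : _root_.IsDiscrete {t : ℝ | IsCriticalValue K X t}) (ℓ p : ℕ+) :
    Nonempty (persistentCupModule K X ℓ p).Barcode := by
  refine (isQTame_persistentCupModule (hX p) ℓ).nonempty_barcode fun a b => ?_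
  have hfin : ({t | IsCriticalValue K X t} ∩ Set.Icc a b).Finite :=
    (isCompact_Icc.inter_left isClosed_setOf_isCriticalValue).finite
      (hcrit.mono Set.inter_subset_left)
  exact hfin.subset (Set.inter_subset_inter_left _ fun t ht =>
    by_contra fun hreg => ht (isRegularAt_persistentCupModule hreg ℓ p))

end CupModule

/-! ### Uniqueness of barcodes -/

namespace PersistenceModule

variable {K : Type v} [Field K]

/-- A morphism of persistence modules. -/
structure Hom (M : PersistenceModule.{v, w} K) (N : PersistenceModule.{v, u} K) where
  /-- the linear map at each parameter -/
  app : ∀ t, M.V t →ₗ[K] N.V t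
  naturality : ∀ {s t : ℝ} (h : s ≤ t) (x : M.V t), app s (M.map h x) = N.map h (app t x)

/-- The composition of morphisms of persistence modules. -/
def Hom.comp {M : PersistenceModule.{v, w} K} {N : PersistenceModule.{v, u} K}
    {P : PersistenceModule.{v, w₁} K} (g : Hom N P) (f : Hom M N) : Hom M P where
  app t := g.app t ∘ₗ f.app t
  naturality h x := by simp only [LinearMap.comp_apply, f.naturality, g.naturality]

/-- The morphism underlying an isomorphism of persistence modules. -/
def Iso.hom {M : PersistenceModule.{v, w} K} {N : PersistenceModule.{v, u} K} (e : Iso M N) :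
    Hom M N where
  app t := e.equiv t
  naturality := e.naturality

/-- The inverse of an isomorphism of persistence modules. -/
def Iso.inv {M : PersistenceModule.{v, w} K} {N : PersistenceModule.{v, u} K} (e : Iso M N) :
    Hom N M where
  app t := (e.equiv t).symm
  naturality {s t} h x := (LinearEquiv.symm_apply_eq _).2 <| by
    rw [e.naturality, LinearEquiv.coe_coe, LinearEquiv.apply_symm_apply]

section DirectSum

variable {ι : Type u} (M : ι → PersistenceModule.{v, w} K) (l : ι)

open Classical in
/-- The inclusion of a summand into a direct sum of persistence modules. -/
def directSumIncl : Hom (M l) (directSum M) where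
  app t := DirectSum.lof K ι (fun l => (M l).V t) l
  naturality h x := (DirectSum.lmap_lof (fun l => (M l).map h) l x).symm

/-- The projection from a direct sum of persistence modules to a summand. -/
def directSumProj : Hom (directSum M) (M l) where
  app t := DirectSum.component K ι (fun l => (M l).V t) l
  naturality h x := DirectSum.lmap_apply (fun l => (M l).map h) x l

theorem directSumProj_directSumIncl {t : ℝ} (x : (M l).V t) :
    (directSumProj M l).app t ((directSumIncl M l).app t x) = x := by
  classical
  exact DirectSum.component.lof_self K (M := fun l => (M l).V t) l x

end DirectSum

section IntervalModule

variable {J J' : Set ℝ} {hJ : J.OrdConnected} {hJ' : J'.OrdConnected} {s t : ℝ}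

theorem intervalUnit_ne_zero (ht : t ∈ J) : (intervalUnit ht : intervalSpace K J t) ≠ 0 :=
  fun h => one_ne_zero (congrArg Subtype.val h)

theorem mem_of_ne_zero {x : (intervalModule K J hJ).V t} (hx : x ≠ 0) : t ∈ J :=
  by_contra fun ht => hx (Subtype.ext (x.2 ht))

theorem map_intervalModule_ne_zero (h : s ≤ t) (hs : s ∈ J) {x : (intervalModule K J hJ).V t}
    (hx : x ≠ 0) : (intervalModule K J hJ).map h x ≠ 0 :=
  fun h0 => hx (Subtype.ext ((if_pos hs).symm.trans (congrArg Subtype.val h0)))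

theorem map_intervalModule_surjective (h : s ≤ t) (ht : t ∈ J) :
    Function.Surjective ((intervalModule K J hJ).map h) := fun x => by
  refine ⟨⟨x.1, fun ht' => absurd ht ht'⟩, Subtype.ext ?_⟩
  by_cases hs : s ∈ J
  · exact if_pos hs
  · exact (if_neg hs).trans (x.2 hs).symm

theorem Hom.inter_Iic_subset (f : Hom (intervalModule K J hJ) (intervalModule K J' hJ'))
    {x : (intervalModule K J hJ).V t} (hx : f.app t x ≠ 0) : J' ∩ Set.Iic t ⊆ J := by
  rintro s ⟨hs, hst : s ≤ t⟩
  have hmap := map_intervalModule_ne_zero hst hs hx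
  rw [← f.naturality] at hmap
  exact mem_of_ne_zero (ne_zero_of_map hmap)

theorem Hom.inter_Ici_subset (f : Hom (intervalModule K J hJ) (intervalModule K J' hJ'))
    {x : (intervalModule K J hJ).V t} (hx : f.app t x ≠ 0) : J ∩ Set.Ici t ⊆ J' := by
  rintro s ⟨hs, hts : t ≤ s⟩
  obtain ⟨y, rfl⟩ := map_intervalModule_surjective hts hs x
  rw [f.naturality] at hx
  exact mem_of_ne_zero (ne_zero_of_map hx)

theorem Hom.eq_of_comp_ne_zero (g : Hom (intervalModule K J' hJ') (intervalModule K J hJ))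
    (f : Hom (intervalModule K J hJ) (intervalModule K J' hJ')) {x : (intervalModule K J hJ).V t}
    (hx : g.app t (f.app t x) ≠ 0) : J = J' := by
  have hfx : f.app t x ≠ 0 := ne_zero_of_map hx
  have hsubset {I I' : Set ℝ} (hIic : I ∩ Set.Iic t ⊆ I') (hIci : I ∩ Set.Ici t ⊆ I') : I ⊆ I' :=
    fun s hs => (le_total s t).elim (fun h => hIic ⟨hs, h⟩) fun h => hIci ⟨hs, h⟩
  exact (hsubset (g.inter_Iic_subset hx) (f.inter_Ici_subset hfx)).antisymm
    (hsubset (f.inter_Iic_subset hfx) (g.inter_Ici_subset hx))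

end IntervalModule

namespace Barcode

variable {M : PersistenceModule.{v, max v w} K} (B : M.Barcode)

/-- The interval module of a bar. -/
abbrev barModule (l : B.ι) : PersistenceModule.{v, v} K :=
  intervalModule K (B.bar l) (B.ordConnected l)

/-- The inclusion of the interval module of a bar. -/
def incl (l : B.ι) : Hom (B.barModule l) M :=
  B.iso.inv.comp (directSumIncl B.barModule l)

/-- The projection to the interval module of a bar. -/
def proj (l : B.ι) : Hom M (B.barModule l) :=
  (directSumProj B.barModule l).comp B.iso.hom

theorem proj_incl {l : B.ι} {t : ℝ} (x : (B.barModule l).V t) :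
    (B.proj l).app t ((B.incl l).app t x) = x :=
  (congrArg ((directSumProj B.barModule l).app t) ((B.iso.equiv t).apply_symm_apply _)).trans
    (directSumProj_directSumIncl B.barModule l x)

theorem exists_apply_incl_proj_ne_zero {N : Type*} [AddCommGroup N] [Module K N] {t : ℝ}
    {f : M.V t →ₗ[K] N} {x : M.V t} (hx : f x ≠ 0) :
    ∃ l, f ((B.incl l).app t ((B.proj l).app t x)) ≠ 0 := by
  classical
  by_contra! h
  let y : ⨁ l, (B.barModule l).V t := B.iso.equiv t x
  let g : (⨁ l, (B.barModule l).V t) →ₗ[K] N := f ∘ₗ (B.iso.equiv t).symm.toLinearMap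
  have hy : g y = f x := congrArg f ((B.iso.equiv t).symm_apply_apply x)
  rw [← hy, ← DirectSum.sum_support_of y, map_sum] at hx
  exact hx (Finset.sum_eq_zero fun l _ => h l)

theorem exists_bar_eq (B B' : M.Barcode) (l : B.ι) : ∃ l', B'.bar l' = B.bar l := by
  obtain ⟨t, ht⟩ := B.nonempty l
  have hne : (B.proj l).app t ((B.incl l).app t (intervalUnit ht)) ≠ 0 :=
    (B.proj_incl _).trans_ne (intervalUnit_ne_zero ht)
  obtain ⟨l', hl'⟩ := B'.exists_apply_incl_proj_ne_zero hne
  exact ⟨l', (Hom.eq_of_comp_ne_zero ((B.proj l).comp (B'.incl l'))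
    ((B'.proj l').comp (B.incl l)) hl').symm⟩

theorem map_ne_zero_iff {s t : ℝ} (h : s ≤ t) :
    M.map h ≠ 0 ↔ ∃ l, Set.Icc s t ⊆ B.bar l := by
  refine ⟨fun hne => ?_, fun ⟨l, hl⟩ h0 => ?_⟩
  · obtain ⟨x, hx⟩ := DFunLike.ne_iff.1 hne
    obtain ⟨l, hl⟩ := B.exists_apply_incl_proj_ne_zero hx
    rw [← (B.incl l).naturality] at hl
    have hmap := ne_zero_of_map hl
    exact ⟨l, (B.ordConnected l).out (mem_of_ne_zero hmap) (mem_of_ne_zero (ne_zero_of_map hmap))⟩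
  · obtain ⟨x, hx⟩ : ∃ x : (B.barModule l).V t, x ≠ 0 :=
      ⟨intervalUnit (hl ⟨h, le_rfl⟩), intervalUnit_ne_zero _⟩
    refine map_intervalModule_ne_zero h (hl ⟨le_rfl, h⟩) hx ?_
    rw [← B.proj_incl ((B.barModule l).map h x), (B.incl l).naturality, h0, LinearMap.zero_apply,
      map_zero]

end Barcode

end PersistenceModule

theorem cupBars_eq {K : Type v} [Field K] {X : ℝ ⥤ TopCat.{u}}
    (B B' : ∀ ℓ p : ℕ+, (persistentCupModule K X ℓ p).Barcode) : cupBars B = cupBars B' := by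
  have hsubset (B B' : ∀ ℓ p : ℕ+, (persistentCupModule K X ℓ p).Barcode) (ℓ : ℕ+) :
      cupBars B ℓ ⊆ cupBars B' ℓ := by
    rintro _ ⟨p, l, rfl⟩
    exact ⟨p, (B ℓ p).exists_bar_eq (B' ℓ p) l⟩
  exact funext fun ℓ => (hsubset B B' ℓ).antisymm (hsubset B' B ℓ)

theorem cupBarLength_eq {K : Type v} [Field K] {X : ℝ ⥤ TopCat.{u}}
    (B B' : ∀ ℓ p : ℕ+, (persistentCupModule K X ℓ p).Barcode) :
    cupBarLength B = cupBarLength B' := by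
  unfold cupBarLength
  rw [cupBars_eq B B']

/-! ### The persistent cup-length -/

section CupLength

theorem prod_ofFn_mem_pow {R A : Type*} [CommSemiring R] [Semiring A] [Algebra R A]
    (P : Submodule R A) : ∀ {n : ℕ} {x : Fin n → A}, (∀ i, x i ∈ P) → (List.ofFn x).prod ∈ P ^ n
  | 0, x, _ => by
    rw [List.ofFn_zero, List.prod_nil, pow_zero]
    exact one_le.1 le_rfl
  | n + 1, x, hx => by
    rw [List.ofFn_succ, List.prod_cons, pow_succ']
    exact mul_mem_mul (hx 0) (prod_ofFn_mem_pow P fun i => hx i.succ)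

variable {K : Type v} [Field K]

variable (K) in
/-- The homogeneous elements of positive degree of the cohomology ring. -/
def positiveHomogeneous (S : SSet.{u}) : Set (CohRing K S) :=
  ⋃ p : ℕ+, LinearMap.range (DirectSum.lof K ℕ (Coh K S) p)

variable {S T : SSet.{u}}

theorem span_positiveHomogeneous : span K (positiveHomogeneous K S) = positivePart K S := by
  simp only [positiveHomogeneous, span_iUnion, span_eq, positivePart]

theorem mul_mem_positiveHomogeneous {x y : CohRing K S} (hx : x ∈ positiveHomogeneous K S)
    (hy : y ∈ positiveHomogeneous K S) : x * y ∈ positiveHomogeneous K S := by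
  obtain ⟨p, a, rfl⟩ := Set.mem_iUnion.1 hx
  obtain ⟨q, b, rfl⟩ := Set.mem_iUnion.1 hy
  exact Set.mem_iUnion.2 ⟨p + q, GradedMonoid.GMul.mul a b, (DirectSum.of_mul_of a b).symm⟩

theorem prod_ofFn_mem_positiveHomogeneous {ℓ : ℕ+} {ξ : Fin ℓ → CohRing K S}
    (hξ : ∀ i, ξ i ∈ positiveHomogeneous K S) : (List.ofFn ξ).prod ∈ positiveHomogeneous K S :=
  List.prod_induction_nonempty (· ∈ positiveHomogeneous K S)
    (fun _ _ => mul_mem_positiveHomogeneous) (mt List.ofFn_eq_nil_iff.1 ℓ.ne_zero)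
    (List.forall_mem_ofFn_iff.2 hξ)

variable {φ : S ⟶ T}

theorem mem_imageGrading_iff {p : ℕ} {η : (cohRingMap K φ).range} :
    η ∈ imageGrading K φ p ↔
      ∃ z : Coh K T p, (cohRingMap K φ).rangeRestrict (DirectSum.lof K ℕ (Coh K T) p z) = η := by
  constructor
  · rintro ⟨y, hy⟩
    obtain ⟨_, x, rfl⟩ := η
    replace hy : DirectSum.lof K ℕ (Coh K S) p y = cohRingMap K φ x := hy
    refine ⟨x p, Subtype.ext ?_⟩
    change cohRingMap K φ (DirectSum.lof K ℕ (Coh K T) p (x p)) = cohRingMap K φ x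
    rw [cohRingMap_lof, ← cohRingMap_apply, ← hy, DirectSum.lof_apply]
  · rintro ⟨z, rfl⟩
    exact ⟨cohMap K φ p z, (cohRingMap_lof K φ p z).symm⟩

theorem exists_positive_mem_imageGrading_iff {η : (cohRingMap K φ).range} :
    (∃ p, 1 ≤ p ∧ η ∈ imageGrading K φ p) ↔
      ∃ ξ ∈ positiveHomogeneous K T, (cohRingMap K φ).rangeRestrict ξ = η := by
  constructor
  · rintro ⟨p, hp, hη⟩
    obtain ⟨z, hz⟩ := mem_imageGrading_iff.1 hη
    exact ⟨_, Set.mem_iUnion.2 ⟨⟨p, hp⟩, z, rfl⟩, hz⟩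
  · rintro ⟨ξ, hξ, hη⟩
    obtain ⟨p, z, rfl⟩ := Set.mem_iUnion.1 hξ
    exact ⟨p, p.2, mem_imageGrading_iff.2 ⟨z, hη⟩⟩

theorem exists_prod_ne_zero_iff_exists_cohRingMap_prod_ne_zero {ℓ : ℕ} :
    (∃ η : Fin ℓ → (cohRingMap K φ).range,
      (∀ i, ∃ p, 1 ≤ p ∧ η i ∈ imageGrading K φ p) ∧ (List.ofFn η).prod ≠ 0) ↔
    ∃ ξ : Fin ℓ → CohRing K T, (∀ i, ξ i ∈ positiveHomogeneous K T) ∧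
      cohRingMap K φ (List.ofFn ξ).prod ≠ 0 := by
  have hprod (ξ : Fin ℓ → CohRing K T) :
      (List.ofFn fun i => (cohRingMap K φ).rangeRestrict (ξ i)).prod =
        (cohRingMap K φ).rangeRestrict (List.ofFn ξ).prod := by
    rw [map_list_prod, List.map_ofFn, Function.comp_def]
  simp only [exists_positive_mem_imageGrading_iff]
  constructor
  · rintro ⟨η, hη, hne⟩
    choose ξ hξ hξη using hη
    obtain rfl := funext hξη
    rw [hprod] at hne
    exact ⟨ξ, hξ, fun h0 => hne (Subtype.ext h0)⟩
  · rintro ⟨ξ, hξ, hne⟩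
    refine ⟨_, fun i => ⟨ξ i, hξ i, rfl⟩, ?_⟩
    rw [hprod]
    exact fun h0 => hne (congrArg Subtype.val h0)

theorem cohRingMap_eq_zero_of_mem_cupPower {ℓ : ℕ}
    (h : ∀ ξ : Fin ℓ → CohRing K T, (∀ i, ξ i ∈ positiveHomogeneous K T) →
      cohRingMap K φ (List.ofFn ξ).prod = 0)
    {x : CohRing K T} (hx : x ∈ cupPower K T ℓ) : cohRingMap K φ x = 0 := by
  have hle : positivePart K T ^ ℓ ≤ LinearMap.ker (cohRingMap K φ).toLinearMap := by
    rw [← span_positiveHomogeneous, span_pow, span_le]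
    intro y hy
    obtain ⟨f, rfl⟩ := Set.mem_pow.1 hy
    exact h (fun i => f i) fun i => (f i).2
  induction hx using NonUnitalAlgebra.adjoin_induction with
  | mem x hx =>
    obtain ⟨ξ, hξ, rfl⟩ := hx
    exact hle (prod_ofFn_mem_pow _ hξ)
  | add x y _ _ hx hy => rw [map_add, hx, hy, add_zero]
  | zero => exact map_zero _
  | mul x y _ _ hx _ => rw [map_mul, hx, zero_mul]
  | smul c x _ hx => rw [map_smul, hx, smul_zero]

theorem exists_cohRingMap_prod_ne_zero_iff_exists_cupPowerMap_ne_zero {ℓ : ℕ+} :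
    (∃ ξ : Fin ℓ → CohRing K T, (∀ i, ξ i ∈ positiveHomogeneous K T) ∧
      cohRingMap K φ (List.ofFn ξ).prod ≠ 0) ↔ ∃ p : ℕ+, cupPowerMap K φ ℓ p ≠ 0 := by
  constructor
  · rintro ⟨ξ, hξ, hne⟩
    obtain ⟨p, z, hz : DirectSum.lof K ℕ (Coh K T) p z = _⟩ :=
      Set.mem_iUnion.1 (prod_ofFn_mem_positiveHomogeneous hξ)
    have hmem : z ∈ cupPowerDeg K T ℓ p := NonUnitalAlgebra.subset_adjoin K
      ⟨ξ, fun i => span_positiveHomogeneous.le (subset_span (hξ i)), hz.symm⟩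
    refine ⟨p, fun h0 => hne ?_⟩
    have hcoh : cohMap K φ p z = 0 :=
      congrArg Subtype.val (LinearMap.congr_fun h0 ⟨z, hmem⟩)
    rw [← hz, cohRingMap_lof, hcoh, map_zero]
  · rintro ⟨p, hp⟩
    by_contra! h
    refine hp (LinearMap.ext fun x => Subtype.ext (lof_injective S p ?_))
    have hx := cohRingMap_eq_zero_of_mem_cupPower h x.2
    rw [cohRingMap_lof] at hx
    exact hx.trans (map_zero _).symm

theorem persistentCupLength_eq {X : ℝ ⥤ TopCat.{u}}
    (B : ∀ ℓ p : ℕ+, (persistentCupModule K X ℓ p).Barcode) {a b : ℝ} (hab : a ≤ b) :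
    persistentCupLength K X hab = ⨆ (J : Set ℝ) (_ : Set.Icc a b ⊆ J), cupBarLength B J := by
  have hiff (ℓ : ℕ+) : (∃ η : Fin ℓ → (cohRingMap K (singMap X hab)).range,
      (∀ i, ∃ p, 1 ≤ p ∧ η i ∈ imageGrading K (singMap X hab) p) ∧ (List.ofFn η).prod ≠ 0) ↔
      ∃ (p : ℕ+) (l : (B ℓ p).ι), Set.Icc a b ⊆ (B ℓ p).bar l :=
    exists_prod_ne_zero_iff_exists_cohRingMap_prod_ne_zero.trans <|
      exists_cohRingMap_prod_ne_zero_iff_exists_cupPowerMap_ne_zero.trans <|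
        exists_congr fun p => (B ℓ p).map_ne_zero_iff hab
  refine le_antisymm (iSup₂_le fun ℓ hℓ => ?_) (iSup₂_le fun J hJ => iSup₂_le ?_)
  · rcases Nat.eq_zero_or_pos ℓ with rfl | hpos
    · exact zero_le
    · obtain ⟨p, l, hl⟩ := (hiff ⟨ℓ, hpos⟩).1 hℓ
      exact le_iSup₂_of_le _ hl <| le_iSup₂_of_le (⟨ℓ, hpos⟩ : ℕ+) ⟨p, l, rfl⟩ le_rfl
  · rintro ℓ ⟨p, l, rfl⟩
    exact le_iSup₂_of_le (f := fun (ℓ : ℕ) _ => (ℓ : ℕ∞)) (ℓ : ℕ) ((hiff ℓ).2 ⟨p, l, hJ⟩) le_rfl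

end CupLength

end CupPersistence

end

theorem mainTheorem9 {K : Type v} [Field K] (X : ℝ ⥤ TopCat.{u}) :
    -- with q-tame cohomology and discrete critical values, the cup modules have barcodes
    ((∀ p : ℕ, (persistentCohomology K X p).IsQTame) →
      _root_.IsDiscrete {t : ℝ | IsCriticalValue K X t} →
        ∀ ℓ p : ℕ+, Nonempty (persistentCupModule K X ℓ p).Barcode) ∧
    -- the persistent cup-length invariant is recovered from any choice of barcodes
    (∀ (B : ∀ ℓ p : ℕ+, (persistentCupModule K X ℓ p).Barcode)
      {a b : ℝ} (hab : a ≤ b),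
        persistentCupLength K X hab =
          ⨆ (J : Set ℝ) (_ : Set.Icc a b ⊆ J), cupBarLength B J) ∧
    -- the values on the bars do not depend on the decompositions into interval modules
    (∀ B B' : ∀ ℓ p : ℕ+, (persistentCupModule K X ℓ p).Barcode,
      cupBarLength B = cupBarLength B') :=
  ⟨nonempty_barcode_persistentCupModule, persistentCupLength_eq, cupBarLength_eq⟩
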